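/- **Setting.** Let $e_1,\dots,e_d$ be the standard basis of $\mathbb R^d$, $\tau=d^{1/5}$, $\mu=d^{-1/5}$. There are $K\le d$ data sources with $c_1d^{1/20}\le K\le c_2d^{1/20}$, and $2K$ classes. The data set $D_k$ of source $k\in[K]$ consists of independent points (also independent across sources): * $n_k$ points of class $2k-1$, distributed as $e_k-\sum_{i\in[K],\,i\ne k}q_i\tau e_i+\mu\xi$, and $n_k$ points of class $2k$, distributed as $-e_k-\sum_{i\in[K],\,i\neq k}q_i\tau e_i+\mu\xi$, where the $q_i$ are independent and uniform on $\{0,1\}$ and $\xi\sim\mathcal N(0,I_d)$ is independent of them (all drawn afresh for every point); * for every $i\in[K]\setminus\{k\}$, $\rho_k$ points of class $2i-1$, distributed as $e_i+\mu\xi$ with $\xi\sim\mathcal N(0,I_d)$, and no point of class $2i$. Here $n_k\ge c_3 d$ and $\rho_k\le c_4d^{\beta}$ for some $\beta\in(0,1)$ with $Kd^\beta\le c_5d^{1/5}$, and $|D_1|=\dots=|D_K|$. Let $m\ge 2K$. For $w\in\mathbb R^{m\times d}$ let $f_w(x)=wx$, $$\mathcal L_k(w)=-\frac1{|D_k|}\sum_{x\in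 D_k}\mathbb E_{\zeta,\zeta'\sim\mathcal N(0,I_d)\text{ i.i.d.}}\big[(w(x+\zeta))^\top(w(x+\zeta'))\big]+\tfrac12\|w^\top w\|_F^2,$$ and let the global objective be $\mathcal L(w)=\sum_{k\in[K]}\frac{|D_k|}{|D|}\mathcal L_k(w)$ with $|D|=\sum_k|D_k|$. The representability vector of $w$ is $r_i=\|\Pi_{\mathcal S}(e_i)\|_2^2$, $i\in[d]$, where $\Pi_{\mathcal S}$ is the orthogonal projection onto the span $\mathcal S\subseteq\mathbb R^d$ of the rows of $w$. **Theorem.** For all constants $c_1,\dots,c_5>0$ and $\beta\in(0,1)$ there are $C>0$ and $d_0$, depending only on these, such that for every $d\ge d_0$ and all $K,m,(n_k),(\rho_k)$ as above, the following holds with probability at least $1-e^{-d^{1/10}}$ over the data. For every $k\in[K]$ the objective $\mathcal L_k$ has a global minimizer, and the representability vector $r^k$ of every global minimizer satisfies $$1-C\,d^{-4/5}\le r^k_i\le 1\qquad\text{for all } i\in[K]\setminus\{k\}.$$ Moreover, the global objective $\mathcal L$ has a global minimizer, and the representability vector $\bar r$ of every global minimizer satisfies $$1-C\,d^{-4/5}\le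 \bar r_i\le 1\qquad\text{for all } i\in[K].$$ -/

import Mathlib

open MeasureTheory ProbabilityTheory

namespace DecSSL

noncomputable section

/-- The standard basis vector of `ℝ^d` with index `i ∈ [K]`, where `K ≤ d`. -/
def basisVec {K d : ℕ} (hKd : K ≤ d) (i : Fin K) : EuclideanSpace ℝ (Fin d) :=
  EuclideanSpace.single (Fin.castLE hKd i) (1 : ℝ)

/-! ### The objectives -/

/-- The linear embedding `f_w(x) = w x`. -/
def embed {m d : ℕ} (w : Matrix (Fin m) (Fin d) ℝ) (x : EuclideanSpace ℝ (Fin d)) :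
    EuclideanSpace ℝ (Fin m) :=
  Matrix.toEuclideanLin w x

/-- The squared Frobenius norm of a real matrix. -/
def frobeniusSq {m n : ℕ} (A : Matrix (Fin m) (Fin n) ℝ) : ℝ :=
  ∑ i, ∑ j, A i j ^ 2

/-- The regularized SimSiam-type loss of a finite data set `x`: the empirical mean over the data
set of the expectation, over two independent standard Gaussian augmentations, of the negative
inner product of the two embeddings, plus the regularizer `‖wᵀ w‖_F² / 2`. -/
def localLoss {ι : Type} [Fintype ι] {m d : ℕ} (x : ι → EuclideanSpace ℝ (Fin d))
    (w : Matrix (Fin m) (Fin d) ℝ) : ℝ :=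
  -((1 / (Fintype.card ι : ℝ)) * ∑ a : ι,
      ∫ p : EuclideanSpace ℝ (Fin d) × EuclideanSpace ℝ (Fin d),
        inner ℝ (embed w (x a + p.1)) (embed w (x a + p.2))
        ∂((stdGaussian (EuclideanSpace ℝ (Fin d))).prod
            (stdGaussian (EuclideanSpace ℝ (Fin d)))))
    + (1 / 2) * frobeniusSq (w.transpose * w)

/-- The data-weighted global objective `∑_k (|D_k| / |D|) L_k(w)`. -/
def globalLoss {K : ℕ} {ι : Fin K → Type} [∀ k, Fintype (ι k)] {m d : ℕ}
    (x : ∀ k, ι k → EuclideanSpace ℝ (Fin d)) (w : Matrix (Fin m) (Fin d) ℝ) : ℝ :=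
  ∑ k, ((Fintype.card (ι k) : ℝ) / (∑ l, (Fintype.card (ι l) : ℝ))) * localLoss (x k) w

/-! ### Representability -/

/-- The subspace of `ℝ^d` spanned by the rows of `w`. -/
def rowSpace {m d : ℕ} (w : Matrix (Fin m) (Fin d) ℝ) :
    Submodule ℝ (EuclideanSpace ℝ (Fin d)) :=
  Submodule.span ℝ (Set.range fun i : Fin m => WithLp.toLp 2 (w i))

/-- The representability vector of the row space `S` of `w`: `r_i = ‖Π_S(e_i)‖²`. -/
def representability {m d : ℕ} (w : Matrix (Fin m) (Fin d) ℝ) (i : Fin d) : ℝ :=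
  ‖(rowSpace w).starProjection (EuclideanSpace.single i (1 : ℝ))‖ ^ 2

/-! ### The data -/

/-- Class `2k-1` (`s = true`) or class `2k` (`s = false`) as it occurs in its majority source `k`:
the law of `± e_k - ∑_{i ≠ k} q_i τ e_i + μ ξ` with `τ = d^{1/5}`, `μ = d^{-1/5}`, the `q_i`
independent and uniform on `{0, 1}`, and `ξ` an independent standard Gaussian vector. -/
def majorityLaw {K d : ℕ} (hKd : K ≤ d) (k : Fin K) (s : Bool) :
    Measure (EuclideanSpace ℝ (Fin d)) :=
  ((Measure.pi fun _ : Fin K => (PMF.uniformOfFintype Bool).toMeasure).prod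
      (stdGaussian (EuclideanSpace ℝ (Fin d)))).map
    fun p : (Fin K → Bool) × EuclideanSpace ℝ (Fin d) =>
      (if s then (1 : ℝ) else -1) • basisVec hKd k
        - ∑ i ∈ Finset.univ.erase k,
            ((if p.1 i then (1 : ℝ) else 0) * (d : ℝ) ^ (1 / 5 : ℝ)) • basisVec hKd i
        + ((d : ℝ) ^ (-(1 / 5) : ℝ)) • p.2

/-- Class `2i-1` as it occurs in a source `k ≠ i`: the law of `e_i + μ ξ`. -/
def minorityLaw {K d : ℕ} (hKd : K ≤ d) (i : Fin K) : Measure (EuclideanSpace ℝ (Fin d)) :=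
  (stdGaussian (EuclideanSpace ℝ (Fin d))).map
    fun z => basisVec hKd i + ((d : ℝ) ^ (-(1 / 5) : ℝ)) • z

/-- The index set of the data points of source `k`: `n k` points of each of the two majority
classes `2k-1` and `2k`, and `r k` points of each class `2i-1` with `i ≠ k`. -/
abbrev SampleIdx {K : ℕ} (n r : Fin K → ℕ) (k : Fin K) : Type :=
  (Bool × Fin (n k)) ⊕ ({i : Fin K // i ≠ k} × Fin (r k))

/-- The law of a single data point of source `k`. -/
def sampleLaw {K d : ℕ} (hKd : K ≤ d) (n r : Fin K → ℕ) (k : Fin K) :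
    SampleIdx n r k → Measure (EuclideanSpace ℝ (Fin d))
  | Sum.inl a => majorityLaw hKd k a.1
  | Sum.inr b => minorityLaw hKd b.1.1

/-- The joint law of all the local data sets: all data points are independent. -/
def dataLaw {K d : ℕ} (hKd : K ≤ d) (n r : Fin K → ℕ) :
    Measure (∀ k : Fin K, SampleIdx n r k → EuclideanSpace ℝ (Fin d)) :=
  Measure.pi fun k => Measure.pi fun a => sampleLaw hKd n r k a

instance {K d : ℕ} (hKd : K ≤ d) (k : Fin K) (s : Bool) :
    IsProbabilityMeasure (majorityLaw hKd k s) := by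
  have hbit : ∀ i : Fin K, Measurable fun p : (Fin K → Bool) × EuclideanSpace ℝ (Fin d) =>
      (if p.1 i then (1 : ℝ) else 0) := fun i =>
    (measurable_of_countable fun b : Bool => if b then (1 : ℝ) else 0).comp
      ((measurable_pi_apply i).comp measurable_fst)
  unfold majorityLaw
  exact Measure.isProbabilityMeasure_map (Measurable.aemeasurable (by fun_prop))

instance {K d : ℕ} (hKd : K ≤ d) (i : Fin K) :
    IsProbabilityMeasure (minorityLaw hKd i) := by
  unfold minorityLaw
  exact Measure.isProbabilityMeasure_map (Measurable.aemeasurable (by fun_prop))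

instance {K d : ℕ} (hKd : K ≤ d) (n r : Fin K → ℕ) (k : Fin K) (a : SampleIdx n r k) :
    IsProbabilityMeasure (sampleLaw hKd n r k a) := by
  cases a <;> unfold sampleLaw <;> infer_instance

instance {K d : ℕ} (hKd : K ≤ d) (n r : Fin K → ℕ) :
    IsProbabilityMeasure (dataLaw hKd n r) := by
  unfold dataLaw
  infer_instance

end

end DecSSL

/-! The augmentations are independent and centred, so averaging over them leaves `‖w x‖²`. Every
local objective is therefore `-tr(w A wᵀ) + ‖wᵀ w‖_F² / 2` with `A` the uncentred second moment
matrix of the data. As all data sets have the same size, the global objective has the same form with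
the average of these matrices. Minimizing it is a form of principal component analysis, but no
spectral theory is needed.

Suppose `A` is at most `M` off the first `K < m` coordinates. Comparing a minimizer `w` with
rank-one perturbations of it shows that `vᵀ A v ≤ M ‖v‖²` for every `v` in the kernel of `w`
(`quadForm_le_of_isMinOn_quarticLoss`). If moreover `κ v_i² ≤ vᵀ A v + M' ‖v‖²` for all `v`, then
kernel vectors have `v_i² ≤ (M + M') / κ · ‖v‖²`. Applied to the projection of `e_i` onto the
kernel, this gives `r_i ≥ 1 - (M + M') / κ`.

It remains to control `A`. Off the first `K` coordinates only the noise `μ ξ` is visible, and an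
operator norm bound for a Gaussian matrix (`measure_exists_lt_sum_inner_sq_le`) gives `M` of order
`μ² = d^{-2/5}`. In a coordinate `i ≠ k`, the random bits of the majority class `2k-1` of source `k`
have variance of order `τ²`. Hoeffding's inequality makes their sign vectors nearly orthogonal, so
`κ` is of order `τ² = d^{2/5}`, with an error `M'` again of order `μ²`. The ratio is of order
`d^{-4/5}`. In the global average the sources other than `i` all see the coordinate `i`, and they
are at least half of the sources. -/

namespace DecSSL
open Matrix

/-! ### Minimizers of the quartic objective -/

/-- The objective `-tr(w A wᵀ) + ‖wᵀ w‖_F² / 2`. -/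
noncomputable def quarticLoss {m d : ℕ} (A : Matrix (Fin d) (Fin d) ℝ)
    (w : Matrix (Fin m) (Fin d) ℝ) : ℝ :=
  -(w * A * wᵀ).trace + (1 / 2) * frobeniusSq (wᵀ * w)

lemma frobeniusSq_add_rank_two {d : ℕ} (P : Matrix (Fin d) (Fin d) ℝ) (hP : P.IsSymm)
    (y a : Fin d → ℝ) :
    frobeniusSq (P + vecMulVec y a + vecMulVec a y + vecMulVec a a) =
      frobeniusSq P + 4 * (y ⬝ᵥ P *ᵥ a) + 2 * (a ⬝ᵥ P *ᵥ a) + 2 * (y ⬝ᵥ y) * (a ⬝ᵥ a)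
        + 2 * (y ⬝ᵥ a) ^ 2 + (a ⬝ᵥ a) ^ 2 + 4 * (y ⬝ᵥ a) * (a ⬝ᵥ a) := by
  have h1 : ∀ u v : Fin d → ℝ, u ⬝ᵥ P *ᵥ v = ∑ i, ∑ j, u i * P i j * v j := by
    intro u v
    simp only [dotProduct, mulVec, Finset.mul_sum]
    exact Finset.sum_congr rfl fun i _ => Finset.sum_congr rfl fun j _ => by ring
  have h3 : ∑ i, ∑ j, a i * P i j * y j = y ⬝ᵥ P *ᵥ a := by
    rw [h1, Finset.sum_comm]
    refine Finset.sum_congr rfl fun i _ => Finset.sum_congr rfl fun j _ => ?_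
    rw [hP.apply]; ring
  have e : ∀ i j, (P + vecMulVec y a + vecMulVec a y + vecMulVec a a) i j ^ 2 =
      P i j ^ 2 + 2 * (y i * P i j * a j) + 2 * (a i * P i j * y j) + 2 * (a i * P i j * a j)
      + (y i * y i) * (a j * a j) + (a i * a i) * (y j * y j) + (a i * a i) * (a j * a j)
      + 2 * ((y i * a i) * (y j * a j)) + 2 * ((y i * a i) * (a j * a j))
      + 2 * ((a i * a i) * (y j * a j)) := by
    intro i j
    simp only [Matrix.add_apply, vecMulVec_apply]
    ring
  unfold frobeniusSq
  simp only [e, Finset.sum_add_distrib, ← Finset.mul_sum, ← Finset.sum_mul, h3, ← h1]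
  have ey : ∑ i, y i * y i = y ⬝ᵥ y := rfl
  have ea : ∑ i, a i * a i = a ⬝ᵥ a := rfl
  have eya : ∑ i, y i * a i = y ⬝ᵥ a := rfl
  rw [ey, ea, eya]
  ring

/-- An exact expansion, so that both the first and the second order conditions at a minimizer can be
read off by scaling `a`. -/
lemma quarticLoss_add_vecMulVec {m d : ℕ} (A : Matrix (Fin d) (Fin d) ℝ) (hA : A.IsSymm)
    (w : Matrix (Fin m) (Fin d) ℝ) (z : Fin m → ℝ) (hz : z ⬝ᵥ z = 1) (a : Fin d → ℝ) :
    quarticLoss A (w + vecMulVec z a) = quarticLoss A w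
      - 2 * ((z ᵥ* w) ⬝ᵥ A *ᵥ a) - a ⬝ᵥ A *ᵥ a
      + 2 * ((z ᵥ* w) ⬝ᵥ (wᵀ * w) *ᵥ a) + a ⬝ᵥ (wᵀ * w) *ᵥ a
      + ((z ᵥ* w) ⬝ᵥ (z ᵥ* w)) * (a ⬝ᵥ a) + ((z ᵥ* w) ⬝ᵥ a) ^ 2
      + (1 / 2) * (a ⬝ᵥ a) ^ 2 + 2 * ((z ᵥ* w) ⬝ᵥ a) * (a ⬝ᵥ a) := by
  have hg : (w + vecMulVec z a)ᵀ * (w + vecMulVec z a) =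
      wᵀ * w + vecMulVec (z ᵥ* w) a + vecMulVec a (z ᵥ* w) + vecMulVec a a := by
    rw [transpose_add, transpose_vecMulVec, Matrix.add_mul, Matrix.mul_add, Matrix.mul_add,
      mul_vecMulVec, vecMulVec_mul, mulVec_transpose, vecMulVec_mul_vecMulVec, hz, one_smul]
    abel
  have ht : ((w + vecMulVec z a) * A * (w + vecMulVec z a)ᵀ).trace =
      (w * A * wᵀ).trace + 2 * ((z ᵥ* w) ⬝ᵥ A *ᵥ a) + a ⬝ᵥ A *ᵥ a := by
    rw [transpose_add, transpose_vecMulVec, Matrix.add_mul, Matrix.mul_add, Matrix.add_mul,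
      Matrix.add_mul, mul_vecMulVec, vecMulVec_mul, vecMulVec_mul, vecMulVec_mul_vecMulVec]
    simp only [trace_add, trace_vecMulVec]
    have e1 : (w * A) *ᵥ a ⬝ᵥ z = (z ᵥ* w) ⬝ᵥ A *ᵥ a := by
      rw [dotProduct_comm, ← mulVec_mulVec, dotProduct_mulVec]
    have e2 : z ⬝ᵥ (a ᵥ* A) ᵥ* wᵀ = (z ᵥ* w) ⬝ᵥ A *ᵥ a := by
      have : a ᵥ* A = A *ᵥ a := by rw [← mulVec_transpose, hA.eq]
      rw [vecMul_transpose, dotProduct_mulVec, this]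
    rw [e1, e2]
    simp [hz, dotProduct_mulVec]
    ring
  have hsymm : (wᵀ * w).IsSymm := by simp [IsSymm, transpose_mul]
  unfold quarticLoss
  rw [hg, ht, frobeniusSq_add_rank_two _ hsymm]
  ring

lemma linear_coeff_eq_zero_of_nonneg {b q c e : ℝ}
    (h : ∀ t : ℝ, 0 ≤ b * t + q * t ^ 2 + c * t ^ 3 + e * t ^ 4) : b = 0 := by
  have hd : HasDerivAt (fun t : ℝ => b * t + q * t ^ 2 + c * t ^ 3 + e * t ^ 4) b 0 := by
    have h1 := ((((hasDerivAt_id' (0 : ℝ)).const_mul b).add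
      ((hasDerivAt_pow 2 (0 : ℝ)).const_mul q)).add
      ((hasDerivAt_pow 3 (0 : ℝ)).const_mul c)).add
      ((hasDerivAt_pow 4 (0 : ℝ)).const_mul e)
    exact h1.congr_deriv (by simp)
  have hm : IsLocalMin (fun t : ℝ => b * t + q * t ^ 2 + c * t ^ 3 + e * t ^ 4) 0 :=
    Filter.Eventually.of_forall fun t => by simpa using h t
  exact hm.hasDerivAt_eq_zero hd

lemma quadratic_coeff_nonneg_of_nonneg {q e : ℝ}
    (h : ∀ t : ℝ, 0 ≤ q * t ^ 2 + e * t ^ 4) : 0 ≤ q := by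
  have ht : Filter.Tendsto (fun t : ℝ => q + e * t ^ 2) (nhdsWithin 0 {0}ᶜ) (nhds q) := by
    have : Continuous fun t : ℝ => q + e * t ^ 2 := by fun_prop
    have := this.tendsto 0
    simp only [ne_eq, OfNat.ofNat_ne_zero, not_false_eq_true, zero_pow, mul_zero, add_zero] at this
    exact this.mono_left nhdsWithin_le_nhds
  refine ge_of_tendsto ht ?_
  filter_upwards [self_mem_nhdsWithin] with t ht
  have h2 : 0 < t ^ 2 := by
    have : t ≠ 0 := ht
    positivity
  have := h t
  nlinarith

/-- A minimizer captures every direction in which `A` is larger than it is on the orthogonal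
complement of the first `K < m` coordinates. -/
lemma quadForm_le_of_isMinOn_quarticLoss {K m d : ℕ} (hKd : K ≤ d) (hKm : K < m)
    (A : Matrix (Fin d) (Fin d) ℝ) (hA : A.IsSymm) {M : ℝ} (hM0 : 0 ≤ M)
    (hM : ∀ v : Fin d → ℝ, (∀ i : Fin K, v (Fin.castLE hKd i) = 0) →
      v ⬝ᵥ A *ᵥ v ≤ M * (v ⬝ᵥ v))
    (w : Matrix (Fin m) (Fin d) ℝ) (hw : IsMinOn (quarticLoss A) Set.univ w)
    (v : Fin d → ℝ) (hv : w *ᵥ v = 0) : v ⬝ᵥ A *ᵥ v ≤ M * (v ⬝ᵥ v) := by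
  -- The `K` conditions on `z ∈ ℝ^m` have a nonzero solution because `K < m`; this is the spare
  -- output direction in which `w` uses none of the first `K` coordinates.
  obtain ⟨z, hz1, hz2⟩ : ∃ z : Fin m → ℝ, z ⬝ᵥ z = 1 ∧
      ∀ i : Fin K, (z ᵥ* w) (Fin.castLE hKd i) = 0 := by
    let T : (Fin m → ℝ) →ₗ[ℝ] (Fin K → ℝ) :=
      (LinearMap.funLeft ℝ ℝ (Fin.castLE hKd)) ∘ₗ (Matrix.vecMulLinear w)
    have hker : LinearMap.ker T ≠ ⊥ := LinearMap.ker_ne_bot_of_finrank_lt (by simpa using hKm)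
    obtain ⟨z, hz, hz0⟩ := (Submodule.ne_bot_iff _).1 hker
    have hpos : 0 < z ⬝ᵥ z :=
      lt_of_le_of_ne (Finset.sum_nonneg fun i _ => mul_self_nonneg _)
        fun h => hz0 (dotProduct_self_eq_zero.1 h.symm)
    refine ⟨(√(z ⬝ᵥ z))⁻¹ • z, ?_, fun i => ?_⟩
    · rw [smul_dotProduct, dotProduct_smul, smul_eq_mul, smul_eq_mul, ← mul_assoc,
        ← mul_inv, Real.mul_self_sqrt hpos.le, inv_mul_cancel₀ hpos.ne']
    · have : T z i = 0 := by rw [LinearMap.mem_ker.1 hz]; rfl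
      rw [smul_vecMul, Pi.smul_apply]
      have h' : (z ᵥ* w) (Fin.castLE hKd i) = 0 := this
      rw [h', smul_zero]
  set y := z ᵥ* w with hy
  have hdelta : ∀ a : Fin d → ℝ, 0 ≤ - 2 * (y ⬝ᵥ A *ᵥ a) - a ⬝ᵥ A *ᵥ a
      + 2 * (y ⬝ᵥ (wᵀ * w) *ᵥ a) + a ⬝ᵥ (wᵀ * w) *ᵥ a
      + (y ⬝ᵥ y) * (a ⬝ᵥ a) + (y ⬝ᵥ a) ^ 2
      + (1 / 2) * (a ⬝ᵥ a) ^ 2 + 2 * (y ⬝ᵥ a) * (a ⬝ᵥ a) := by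
    intro a
    have h1 := isMinOn_univ_iff.1 hw (w + vecMulVec z a)
    rw [quarticLoss_add_vecMulVec A hA w z hz1 a] at h1
    linarith
  have hPy : ∀ a, y ⬝ᵥ (wᵀ * w) *ᵥ a = (w *ᵥ y) ⬝ᵥ (w *ᵥ a) := by
    intro a
    rw [← mulVec_mulVec, dotProduct_mulVec, vecMul_transpose]
  -- First order condition for the perturbations `t z yᵀ`, which rescale the component of `w` along
  -- `z`.
  have hstat : y ⬝ᵥ A *ᵥ y = (w *ᵥ y) ⬝ᵥ (w *ᵥ y) := by
    have := linear_coeff_eq_zero_of_nonneg (b := - 2 * (y ⬝ᵥ A *ᵥ y) + 2 * (y ⬝ᵥ (wᵀ * w) *ᵥ y))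
      (q := - (y ⬝ᵥ A *ᵥ y) + y ⬝ᵥ (wᵀ * w) *ᵥ y + (y ⬝ᵥ y) * (y ⬝ᵥ y) + (y ⬝ᵥ y) ^ 2)
      (c := 2 * (y ⬝ᵥ y) * (y ⬝ᵥ y)) (e := (1 / 2) * (y ⬝ᵥ y) ^ 2) (fun t => by
        have := hdelta (t • y)
        simp only [mulVec_smul, dotProduct_smul, smul_dotProduct, smul_eq_mul] at this
        linarith)
    rw [hPy] at this
    linarith
  have hyw : y ⬝ᵥ y = z ⬝ᵥ (w *ᵥ y) := by rw [dotProduct_mulVec]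
  have hcs : (y ⬝ᵥ y) ^ 2 ≤ (w *ᵥ y) ⬝ᵥ (w *ᵥ y) := by
    rw [hyw]
    have := Finset.sum_mul_sq_le_sq_mul_sq Finset.univ z (w *ᵥ y)
    have e1 : ∑ i, z i ^ 2 = 1 := by rw [← hz1]; simp [dotProduct, sq]
    have e2 : ∑ i, (w *ᵥ y) i ^ 2 = (w *ᵥ y) ⬝ᵥ (w *ᵥ y) := by simp [dotProduct, sq]
    rw [e1, e2, one_mul] at this
    exact this
  -- The chain `‖y‖⁴ ≤ ‖w y‖² = yᵀ A y ≤ M ‖y‖²`.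
  have hyM : y ⬝ᵥ y ≤ M := by
    have h1 := hM y hz2
    have h0 : 0 ≤ y ⬝ᵥ y := Finset.sum_nonneg fun i _ => mul_self_nonneg _
    by_contra! hlt
    nlinarith
  have hyv : y ⬝ᵥ v = 0 := by rw [hy, ← dotProduct_mulVec, hv, dotProduct_zero]
  -- Second order condition for the perturbations `t z vᵀ`. Adding the inequalities for `t` and `-t`
  -- removes the linear term in `yᵀ A v`; the other cross terms vanish since `w v = 0` and `y ⬝ᵥ v =
  -- 0`.
  have hq : 0 ≤ - (v ⬝ᵥ A *ᵥ v) + (y ⬝ᵥ y) * (v ⬝ᵥ v) := by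
    refine quadratic_coeff_nonneg_of_nonneg (e := (1 / 2) * (v ⬝ᵥ v) ^ 2) fun t => ?_
    have h1 := hdelta (t • v)
    have h2 := hdelta (-t • v)
    simp only [mulVec_smul, dotProduct_smul, smul_dotProduct, smul_eq_mul, ← mulVec_mulVec, hv,
      mulVec_zero, dotProduct_zero, mul_zero, hyv, zero_mul] at h1 h2
    nlinarith
  have h0 : 0 ≤ v ⬝ᵥ v := Finset.sum_nonneg fun i _ => mul_self_nonneg _
  nlinarith

lemma continuous_quarticLoss {m d : ℕ} (A : Matrix (Fin d) (Fin d) ℝ) :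
    Continuous (quarticLoss A : Matrix (Fin m) (Fin d) ℝ → ℝ) := by
  unfold quarticLoss frobeniusSq
  have h1 : Continuous fun w : Matrix (Fin m) (Fin d) ℝ => (w * A * wᵀ).trace := by fun_prop
  have h2 : Continuous fun w : Matrix (Fin m) (Fin d) ℝ => wᵀ * w := by fun_prop
  have h3 : ∀ i j, Continuous fun w : Matrix (Fin m) (Fin d) ℝ => (wᵀ * w) i j :=
    fun i j => h2.matrix_elem i j
  fun_prop

/-- Coercivity: the trace is at most a constant times `N w = ‖w‖_F²`, while `N w ^ 2 ≤ d ‖wᵀ w‖_F²`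
by Cauchy–Schwarz on the diagonal. Outside a large box the loss is thus at least its value `0` at `w
= 0`. -/
lemma exists_isMinOn_quarticLoss {m d : ℕ} (A : Matrix (Fin d) (Fin d) ℝ) :
    ∃ w : Matrix (Fin m) (Fin d) ℝ, IsMinOn (quarticLoss A) Set.univ w := by
  set a : ℝ := d * ∑ j, ∑ k, |A j k| with ha
  have ha0 : 0 ≤ a := by positivity
  set N : Matrix (Fin m) (Fin d) ℝ → ℝ := fun w => ∑ i, ∑ j, w i j ^ 2 with hN
  have hentry : ∀ w : Matrix (Fin m) (Fin d) ℝ, ∀ i j, w i j ^ 2 ≤ N w := fun w i j =>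
    (Finset.single_le_sum (f := fun j => w i j ^ 2) (fun _ _ => sq_nonneg _)
      (Finset.mem_univ j)).trans
    (Finset.single_le_sum (f := fun i => ∑ j, w i j ^ 2)
      (fun _ _ => Finset.sum_nonneg fun _ _ => sq_nonneg _) (Finset.mem_univ i))
  have htr : ∀ w : Matrix (Fin m) (Fin d) ℝ,
      (w * A * wᵀ).trace ≤ (∑ j, ∑ k, |A j k|) * N w := by
    intro w
    have e : (w * A * wᵀ).trace = ∑ j, ∑ k, A j k * ∑ i, w i j * w i k := by
      simp only [trace, diag_apply, mul_apply, transpose_apply, Finset.sum_mul, Finset.mul_sum]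
      rw [Finset.sum_comm]
      rw [Finset.sum_congr rfl fun k _ => Finset.sum_comm]
      rw [Finset.sum_comm]
      exact Finset.sum_congr rfl fun j _ => Finset.sum_congr rfl fun k _ =>
        Finset.sum_congr rfl fun i _ => by ring
    rw [e, Finset.sum_mul]
    refine Finset.sum_le_sum fun j _ => ?_
    rw [Finset.sum_mul]
    refine Finset.sum_le_sum fun k _ => ?_
    have hb : |∑ i, w i j * w i k| ≤ N w := by
      refine (Finset.abs_sum_le_sum_abs _ _).trans (Finset.sum_le_sum fun i _ => ?_)
      have hs : ∀ j, w i j ^ 2 ≤ ∑ j, w i j ^ 2 := fun j =>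
        Finset.single_le_sum (f := fun j => w i j ^ 2) (fun _ _ => sq_nonneg _)
          (Finset.mem_univ j)
      have h1 := hs j
      have h2 := hs k
      rw [abs_le]
      constructor <;> nlinarith [sq_nonneg (w i j + w i k), sq_nonneg (w i j - w i k)]
    refine (le_abs_self _).trans ?_
    rw [abs_mul]
    exact mul_le_mul_of_nonneg_left hb (abs_nonneg _)
  have hfr : ∀ w : Matrix (Fin m) (Fin d) ℝ, N w ^ 2 ≤ d * frobeniusSq (wᵀ * w) := by
    intro w
    have e : N w = ∑ j, (wᵀ * w) j j := by
      simp only [hN, mul_apply, transpose_apply]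
      rw [Finset.sum_comm]
      exact Finset.sum_congr rfl fun j _ => Finset.sum_congr rfl fun i _ => by ring
    rw [e]
    have h1 := sq_sum_le_card_mul_sum_sq (s := Finset.univ) (f := fun j => (wᵀ * w) j j)
    simp only [Finset.card_univ, Fintype.card_fin] at h1
    refine h1.trans (mul_le_mul_of_nonneg_left (Finset.sum_le_sum fun j _ => ?_) (by positivity))
    exact Finset.single_le_sum (f := fun k => (wᵀ * w) j k ^ 2) (fun _ _ => sq_nonneg _)
      (Finset.mem_univ j)
  set R : ℝ := 2 * a + 1 with hR
  let B : Set (Matrix (Fin m) (Fin d) ℝ) :=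
    Set.univ.pi fun _ => Set.univ.pi fun _ => Set.Icc (-R) R
  have hB : IsCompact B := isCompact_univ_pi fun _ => isCompact_univ_pi fun _ => isCompact_Icc
  have h0B : (0 : Matrix (Fin m) (Fin d) ℝ) ∈ B := by
    intro i _ j _
    change (0 : ℝ) ∈ Set.Icc (-R) R
    exact ⟨by linarith, by linarith⟩
  obtain ⟨w, hwB, hw⟩ := hB.exists_isMinOn ⟨0, h0B⟩ (continuous_quarticLoss A).continuousOn
  refine ⟨w, isMinOn_univ_iff.2 fun u => ?_⟩
  by_cases hu : u ∈ B
  · exact isMinOn_iff.1 hw u hu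
  · have h0 : quarticLoss A (0 : Matrix (Fin m) (Fin d) ℝ) = 0 := by
      simp [quarticLoss, frobeniusSq]
    refine ((isMinOn_iff.1 hw 0 h0B).trans_eq h0).trans ?_
    obtain ⟨i, j, hij⟩ : ∃ i j, u i j ∉ Set.Icc (-R) R := by
      by_contra! hc
      exact hu fun i _ j _ => hc i j
    have hNR : 2 * a ≤ N u := by
      refine le_trans ?_ (hentry u i j)
      rw [Set.mem_Icc, ← abs_le, not_le] at hij
      rw [← sq_abs]
      nlinarith
    have hd : (1 : ℝ) ≤ d := by
      have : 0 < d := Fin.pos j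
      exact_mod_cast this
    have h1 := htr u
    have h2 := hfr u
    have hN0 : 0 ≤ N u := by linarith
    have h3 : 2 * a * N u ≤ d * frobeniusSq (uᵀ * u) := by nlinarith
    have h4 : d * (2 * ((∑ j, ∑ k, |A j k|) * N u)) ≤ d * frobeniusSq (uᵀ * u) := by
      rw [ha] at h3; linarith
    have h5 := le_of_mul_le_mul_left h4 (by linarith)
    unfold quarticLoss
    linarith

lemma mulVec_eq_zero_of_mem_rowSpace_orthogonal {m d : ℕ} {w : Matrix (Fin m) (Fin d) ℝ}
    {v : EuclideanSpace ℝ (Fin d)} (hv : v ∈ (rowSpace w)ᗮ) : w *ᵥ v.ofLp = 0 := by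
  ext i
  have := Submodule.inner_right_of_mem_orthogonal
    (Submodule.subset_span (Set.mem_range_self i) : WithLp.toLp 2 (w i) ∈ rowSpace w) hv
  rw [EuclideanSpace.inner_eq_star_dotProduct, dotProduct_comm] at this
  simpa [mulVec] using this

lemma representability_le_one {m d : ℕ} (w : Matrix (Fin m) (Fin d) ℝ) (i : Fin d) :
    representability w i ≤ 1 := by
  unfold representability
  have := (rowSpace w).norm_starProjection_apply_le (EuclideanSpace.single i (1 : ℝ))
  rw [PiLp.norm_single, norm_one] at this
  exact pow_le_one₀ (norm_nonneg _) this

/-- The projection `u` of `e_i` onto the orthogonal complement of the row space lies in the kernel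
of `w` and satisfies `u_i = ‖u‖² = 1 - r_i`. The hypothesis for `u` then reads `‖u‖⁴ ≤ δ ‖u‖²`. -/
lemma one_sub_le_representability {m d : ℕ} (w : Matrix (Fin m) (Fin d) ℝ) (i : Fin d) {δ : ℝ}
    (h : ∀ v : Fin d → ℝ, w *ᵥ v = 0 → v i ^ 2 ≤ δ * (v ⬝ᵥ v)) (hδ : 0 ≤ δ) :
    1 - δ ≤ representability w i := by
  set e : EuclideanSpace ℝ (Fin d) := EuclideanSpace.single i (1 : ℝ) with he
  set u := (rowSpace w)ᗮ.starProjection e with hu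
  have hsum : ‖e‖ ^ 2 = ‖(rowSpace w).starProjection e‖ ^ 2 + ‖u‖ ^ 2 :=
    Submodule.norm_sq_eq_add_norm_sq_starProjection e (rowSpace w)
  have humem : u ∈ (rowSpace w)ᗮ := Submodule.starProjection_apply_mem _ _
  have hue : ‖u‖ ^ 2 = u i := by
    have h1 : inner ℝ u e = ‖u‖ ^ 2 := by
      have := Submodule.starProjection_inner_eq_zero (K := (rowSpace w)ᗮ) e u humem
      rw [inner_sub_left, sub_eq_zero, real_inner_comm] at this
      rw [this, real_inner_self_eq_norm_sq]
    rw [← h1, he, EuclideanSpace.inner_single_right]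
    simp
  have huu : u.ofLp ⬝ᵥ u.ofLp = ‖u‖ ^ 2 := by
    rw [EuclideanSpace.real_norm_sq_eq]
    simp [dotProduct, sq]
  have h1 := h u.ofLp (mulVec_eq_zero_of_mem_rowSpace_orthogonal humem)
  rw [huu, ← hue] at h1
  have h2 : ‖u‖ ^ 2 ≤ δ := by
    have := sq_nonneg ‖u‖
    by_contra! hlt
    nlinarith
  have h3 : ‖e‖ = 1 := by rw [he, PiLp.norm_single, norm_one]
  rw [h3] at hsum
  unfold representability
  linarith

/-- If `A` is at most `M` off the first `K < m` coordinates, and at least `κ ∑_{i ∈ I} v_i²` up to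
an error of `M' ‖v‖²`, then every minimizer represents the coordinates in `I`. -/
lemma one_sub_le_representability_of_isMinOn {K m d : ℕ} (hKd : K ≤ d) (hKm : K < m)
    (A : Matrix (Fin d) (Fin d) ℝ) (hA : A.IsSymm) {M M' κ : ℝ} (hM0 : 0 ≤ M) (hM' : 0 ≤ M')
    (hκ : 0 < κ)
    (hM : ∀ v : Fin d → ℝ, (∀ i : Fin K, v (Fin.castLE hKd i) = 0) →
      v ⬝ᵥ A *ᵥ v ≤ M * (v ⬝ᵥ v))
    (i : Fin K)
    (hlow : ∀ v : Fin d → ℝ,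
      κ * v (Fin.castLE hKd i) ^ 2 ≤ v ⬝ᵥ A *ᵥ v + M' * (v ⬝ᵥ v))
    (w : Matrix (Fin m) (Fin d) ℝ) (hw : IsMinOn (quarticLoss A) Set.univ w) :
    1 - (M + M') / κ ≤ representability w (Fin.castLE hKd i) := by
  refine one_sub_le_representability w _ (fun v hv => ?_) (by positivity)
  have h1 := quadForm_le_of_isMinOn_quarticLoss hKd hKm A hA hM0 hM w hw v hv
  have h2 := hlow v
  rw [div_mul_eq_mul_div, le_div_iff₀ hκ]
  linarith

end DecSSL
-- Concentration: Gaussian operator norm and Hoeffding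
namespace DecSSL

lemma lintegral_exp_sq_div_four_gaussianReal_le :
    ∫⁻ x, ENNReal.ofReal (Real.exp (x ^ 2 / 4)) ∂(gaussianReal 0 1) ≤ 2 := by
  rw [gaussianReal_of_var_ne_zero _ one_ne_zero,
    lintegral_withDensity_eq_lintegral_mul _ (measurable_gaussianPDF 0 1) (by fun_prop)]
  have e : ∀ x : ℝ, (gaussianPDF 0 1 * fun x => ENNReal.ofReal (Real.exp (x ^ 2 / 4))) x =
      ENNReal.ofReal ((√(2 * Real.pi))⁻¹ * Real.exp (-(1 / 4) * x ^ 2)) := by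
    intro x
    rw [Pi.mul_apply, gaussianPDF, ← ENNReal.ofReal_mul (gaussianPDFReal_nonneg 0 1 x),
      gaussianPDFReal, mul_assoc, ← Real.exp_add]
    congr 2
    · simp
    · congr 1
      simp only [NNReal.coe_one]
      ring
  rw [lintegral_congr e, ← ofReal_integral_eq_lintegral_ofReal]
  · rw [integral_const_mul, integral_gaussian]
    have h2 : √(Real.pi / (1 / 4)) = √2 * √(2 * Real.pi) := by
      rw [← Real.sqrt_mul (by norm_num)]
      congr 1
      ring
    rw [h2, mul_comm, mul_assoc, mul_inv_cancel₀ (by positivity), mul_one]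
    have : √2 ≤ 2 := by
      rw [Real.sqrt_le_left (by norm_num)]
      norm_num
    calc ENNReal.ofReal √2 ≤ ENNReal.ofReal 2 := ENNReal.ofReal_le_ofReal this
      _ = 2 := by simp
  · exact (integrable_exp_neg_mul_sq (by norm_num)).const_mul _
  · exact Filter.Eventually.of_forall fun x => by positivity

section NoiseNorm

variable {E : Type*} [NormedAddCommGroup E] [InnerProductSpace ℝ E] [FiniteDimensional ℝ E]
  [MeasurableSpace E] [BorelSpace E]

lemma map_inner_stdGaussian (v : E) :
    (stdGaussian E).map (fun x => inner ℝ v x) = (gaussianReal 0 1).map (‖v‖ * ·) := by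
  have h := IsGaussian.map_eq_gaussianReal (μ := stdGaussian E) (innerSL ℝ v)
  rw [integral_strongDual_stdGaussian, variance_dual_stdGaussian, innerSL_apply_norm] at h
  rw [gaussianReal_map_const_mul]
  simp only [mul_zero, mul_one]
  rw [show (fun x => inner ℝ v x) = ⇑(innerSL ℝ v) from rfl, h]
  congr 1
  exact Real.toNNReal_of_nonneg (sq_nonneg _)

/-- The radius `2` is what the averaging argument over unit balls centred on the unit sphere
requires; the factor `1/16` then leaves at most `g² / 4` in the exponent, whose exponential moment
is `√2`. -/
lemma lintegral_exp_inner_sq_stdGaussian_le (v : E) (hv : ‖v‖ ≤ 2) :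
    ∫⁻ x, ENNReal.ofReal (Real.exp (inner ℝ v x ^ 2 / 16)) ∂(stdGaussian E) ≤ 2 := by
  have h1 : ∫⁻ x, ENNReal.ofReal (Real.exp (inner ℝ v x ^ 2 / 16)) ∂(stdGaussian E) =
      ∫⁻ g, ENNReal.ofReal (Real.exp (g ^ 2 / 16))
        ∂((stdGaussian E).map (fun x => inner ℝ v x)) := by
    rw [lintegral_map (by fun_prop) (by fun_prop)]
  rw [h1, map_inner_stdGaussian, lintegral_map (by fun_prop) (by fun_prop)]
  refine le_trans (lintegral_mono fun g => ?_) lintegral_exp_sq_div_four_gaussianReal_le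
  refine ENNReal.ofReal_le_ofReal (Real.exp_le_exp.2 ?_)
  have : ‖v‖ ^ 2 ≤ 4 := by nlinarith [norm_nonneg v]
  nlinarith [sq_nonneg g, mul_le_mul_of_nonneg_right this (sq_nonneg g)]

lemma two_mul_exp_le_exp_add_exp {s p q : ℝ} (h : 2 * s ≤ p + q) :
    2 * Real.exp s ≤ Real.exp p + Real.exp q := by
  have h1 : Real.exp p = Real.exp s * Real.exp (p - s) := by rw [← Real.exp_add]; congr 1; ring
  have h2 : Real.exp q = Real.exp s * Real.exp (q - s) := by rw [← Real.exp_add]; congr 1; ring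
  have h3 := Real.add_one_le_exp (p - s)
  have h4 := Real.add_one_le_exp (q - s)
  rw [h1, h2]
  nlinarith [Real.exp_pos s]

variable {ι : Type*} [Fintype ι]

/-- The average of `exp (∑ ⟪v, ξ_a⟫² / 16)` over a ball is at least the value at the centre. -/
lemma exp_sum_inner_sq_le_setLIntegral_ball (ξ : ι → E) (v : E) :
    ENNReal.ofReal (Real.exp (∑ a, inner ℝ v (ξ a) ^ 2 / 16)) * volume (Metric.ball v 1) ≤
      ∫⁻ u in Metric.ball v 1, ENNReal.ofReal (Real.exp (∑ a, inner ℝ u (ξ a) ^ 2 / 16)) := by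
  set F : E → ENNReal := fun u => ENNReal.ofReal (Real.exp (∑ a, inner ℝ u (ξ a) ^ 2 / 16))
    with hF
  have hFm : Measurable F := by fun_prop
  -- The point reflection in `v` preserves the ball, so midpoint convexity of the exponential of a
  -- nonnegative quadratic form gives the mean value inequality.
  have hmp : MeasurePreserving (fun u : E => (2 : ℝ) • v - u) volume volume :=
    Measure.measurePreserving_sub_left volume _
  have hpre : (fun u : E => (2 : ℝ) • v - u) ⁻¹' Metric.ball v 1 = Metric.ball v 1 := by
    ext u
    simp only [Set.mem_preimage, Metric.mem_ball, dist_eq_norm]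
    rw [← norm_neg (u - v)]
    congr! 2
    module
  have hrefl : ∫⁻ u in Metric.ball v 1, F ((2 : ℝ) • v - u) = ∫⁻ u in Metric.ball v 1, F u := by
    have := hmp.setLIntegral_comp_preimage (s := Metric.ball v 1) Metric.isOpen_ball.measurableSet
      hFm
    rwa [hpre] at this
  have hpt : ∀ u, 2 * F v ≤ F u + F ((2 : ℝ) • v - u) := by
    intro u
    simp only [hF]
    rw [← ENNReal.ofReal_add (Real.exp_pos _).le (Real.exp_pos _).le,
      show (2 : ENNReal) = ENNReal.ofReal 2 by simp, ← ENNReal.ofReal_mul (by norm_num)]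
    refine ENNReal.ofReal_le_ofReal (two_mul_exp_le_exp_add_exp ?_)
    rw [Finset.mul_sum, ← Finset.sum_add_distrib]
    refine Finset.sum_le_sum fun a _ => ?_
    rw [inner_sub_left, real_inner_smul_left]
    nlinarith [sq_nonneg (inner ℝ u (ξ a) - inner ℝ v (ξ a))]
  have h2 : 2 * (F v * volume (Metric.ball v 1)) ≤ 2 * ∫⁻ u in Metric.ball v 1, F u := by
    calc 2 * (F v * volume (Metric.ball v 1)) = ∫⁻ _ in Metric.ball v 1, 2 * F v := by
          rw [setLIntegral_const, mul_assoc]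
      _ ≤ ∫⁻ u in Metric.ball v 1, (F u + F ((2 : ℝ) • v - u)) := lintegral_mono hpt
      _ = 2 * ∫⁻ u in Metric.ball v 1, F u := by
          rw [lintegral_add_left hFm, hrefl, two_mul]
  exact (ENNReal.mul_le_mul_iff_right two_ne_zero ENNReal.ofNat_ne_top).1 h2

lemma lintegral_exp_sum_inner_sq_pi_stdGaussian_le (v : E) (hv : ‖v‖ ≤ 2) :
    ∫⁻ ξ, ENNReal.ofReal (Real.exp (∑ a, inner ℝ v (ξ a) ^ 2 / 16))
      ∂(Measure.pi fun _ : ι => stdGaussian E) ≤ 2 ^ Fintype.card ι := by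
  have hm : Measurable fun x : E => ENNReal.ofReal (Real.exp (inner ℝ v x ^ 2 / 16)) := by
    fun_prop
  have hind : iIndepFun (fun (a : ι) (ξ : ι → E) =>
      ENNReal.ofReal (Real.exp (inner ℝ v (ξ a) ^ 2 / 16)))
      (Measure.pi fun _ : ι => stdGaussian E) :=
    iIndepFun_pi (X := fun (_ : ι) (x : E) => ENNReal.ofReal (Real.exp (inner ℝ v x ^ 2 / 16)))
      fun _ => hm.aemeasurable
  have hprod : ∀ ξ : ι → E, ENNReal.ofReal (Real.exp (∑ a, inner ℝ v (ξ a) ^ 2 / 16)) =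
      ∏ a, ENNReal.ofReal (Real.exp (inner ℝ v (ξ a) ^ 2 / 16)) := by
    intro ξ
    rw [Real.exp_sum, ENNReal.ofReal_prod_of_nonneg fun _ _ => (Real.exp_pos _).le]
  simp_rw [hprod]
  rw [lintegral_prod_eq_prod_lintegral_of_indepFun Finset.univ _ hind
    fun a => hm.comp (measurable_pi_apply a)]
  refine (Finset.prod_le_pow_card _ _ 2 fun a _ => ?_).trans_eq (by rw [Finset.card_univ])
  have := (measurePreserving_eval (fun _ : ι => stdGaussian E) a).lintegral_comp hm
  exact this.trans_le (lintegral_exp_inner_sq_stdGaussian_le v hv)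

/-- A tail bound for the operator norm of a Gaussian matrix. -/
lemma measure_exists_lt_sum_inner_sq_le {B : ℝ} :
    (Measure.pi fun _ : ι => stdGaussian E)
      {ξ | ∃ v : E, B * ‖v‖ ^ 2 < ∑ a, inner ℝ v (ξ a) ^ 2} ≤
    ENNReal.ofReal (2 ^ (Module.finrank ℝ E + Fintype.card ι) * Real.exp (-(B / 16))) := by
  set P := Measure.pi fun _ : ι => stdGaussian E
  set Φ : (ι → E) → ENNReal := fun ξ =>
    ∫⁻ u in Metric.ball 0 2, ENNReal.ofReal (Real.exp (∑ a, inner ℝ u (ξ a) ^ 2 / 16)) with hΦ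
  have hm : Measurable (Function.uncurry fun (ξ : ι → E) (u : E) =>
      ENNReal.ofReal (Real.exp (∑ a, inner ℝ u (ξ a) ^ 2 / 16))) := by
    unfold Function.uncurry
    fun_prop
  set V : ENNReal := volume (Metric.ball (0 : E) 1) with hV
  have hV0 : V ≠ 0 := (Metric.measure_ball_pos volume 0 one_pos).ne'
  have hVt : V ≠ ⊤ := measure_ball_lt_top.ne
  -- This replaces a net on the sphere: a large value at one unit vector forces a large integral
  -- over the ball of radius `2`. Markov's inequality for that integral then costs only the volume
  -- ratio `2 ^ finrank` and the moment bound `2 ^ card`.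
  have hsub : {ξ | ∃ v : E, B * ‖v‖ ^ 2 < ∑ a, inner ℝ v (ξ a) ^ 2} ⊆
      {ξ | ENNReal.ofReal (Real.exp (B / 16)) * V ≤ Φ ξ} := by
    rintro ξ ⟨v, hv⟩
    have hv0 : v ≠ 0 := by
      rintro rfl
      simp at hv
    have hvn : 0 < ‖v‖ := norm_pos_iff.2 hv0
    set u : E := ‖v‖⁻¹ • v with hu
    have hun : ‖u‖ = 1 := by rw [hu, norm_smul, norm_inv, norm_norm, inv_mul_cancel₀ hvn.ne']
    have hBu : B ≤ ∑ a, inner ℝ u (ξ a) ^ 2 := by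
      have : ∑ a, inner ℝ u (ξ a) ^ 2 = (‖v‖ ^ 2)⁻¹ * ∑ a, inner ℝ v (ξ a) ^ 2 := by
        rw [Finset.mul_sum]
        refine Finset.sum_congr rfl fun a _ => ?_
        rw [hu, real_inner_smul_left, mul_pow, inv_pow]
      rw [this, ← div_eq_inv_mul, le_div_iff₀ (by positivity)]
      exact hv.le
    have hball : volume (Metric.ball u 1) = V := by
      rw [hV, Measure.addHaar_ball_center]
    calc ENNReal.ofReal (Real.exp (B / 16)) * V
        ≤ ENNReal.ofReal (Real.exp (∑ a, inner ℝ u (ξ a) ^ 2 / 16)) *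
            volume (Metric.ball u 1) := by
          rw [hball]
          gcongr
          rw [← Finset.sum_div]
          gcongr
      _ ≤ _ := exp_sum_inner_sq_le_setLIntegral_ball ξ u
      _ ≤ Φ ξ := by
          refine lintegral_mono_set (Metric.ball_subset_ball' ?_)
          rw [dist_zero_right, hun]
          norm_num
  have hint : ∫⁻ ξ, Φ ξ ∂P ≤ ENNReal.ofReal (2 ^ (Module.finrank ℝ E + Fintype.card ι)) * V := by
    rw [hΦ, lintegral_lintegral_swap hm.aemeasurable]
    calc ∫⁻ u in Metric.ball (0 : E) 2,
          ∫⁻ ξ, ENNReal.ofReal (Real.exp (∑ a, inner ℝ u (ξ a) ^ 2 / 16)) ∂P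
        ≤ ∫⁻ _ in Metric.ball (0 : E) 2, 2 ^ Fintype.card ι := by
          refine setLIntegral_mono measurable_const fun u hu => ?_
          rw [Metric.mem_ball, dist_zero_right] at hu
          exact lintegral_exp_sum_inner_sq_pi_stdGaussian_le u hu.le
      _ = ENNReal.ofReal (2 ^ (Module.finrank ℝ E + Fintype.card ι)) * V := by
          rw [setLIntegral_const, Measure.addHaar_ball_of_pos volume _ (by norm_num), pow_add,
            ENNReal.ofReal_mul (by positivity), ENNReal.ofReal_pow (by norm_num) (Fintype.card ι)]
          simp only [ENNReal.ofReal_ofNat]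
          ring
  have hc0 : ENNReal.ofReal (Real.exp (B / 16)) * V ≠ 0 :=
    mul_ne_zero (by simpa using Real.exp_pos _) hV0
  have hct : ENNReal.ofReal (Real.exp (B / 16)) * V ≠ ⊤ :=
    ENNReal.mul_ne_top ENNReal.ofReal_ne_top hVt
  have hΦm : Measurable Φ := by
    exact hm.lintegral_prod_right'
  calc P _ ≤ P {ξ | ENNReal.ofReal (Real.exp (B / 16)) * V ≤ Φ ξ} := measure_mono hsub
    _ ≤ (∫⁻ ξ, Φ ξ ∂P) / (ENNReal.ofReal (Real.exp (B / 16)) * V) :=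
        meas_ge_le_lintegral_div hΦm.aemeasurable hc0 hct
    _ ≤ (ENNReal.ofReal (2 ^ (Module.finrank ℝ E + Fintype.card ι)) * V) /
          (ENNReal.ofReal (Real.exp (B / 16)) * V) := by gcongr
    _ = _ := by
        rw [ENNReal.mul_div_mul_right _ _ hV0 hVt, Real.exp_neg, ← div_eq_mul_inv,
          ENNReal.ofReal_div_of_pos (Real.exp_pos _)]

end NoiseNorm

/-- Hoeffding's inequality for a centred function of independent copies. -/
lemma measureReal_le_abs_sum_le {Ω ι : Type*} [MeasurableSpace Ω] [Fintype ι] (μ : Measure Ω)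
    [IsProbabilityMeasure μ] {f : Ω → ℝ} (hf : Measurable f) (hb : ∀ ω, |f ω| ≤ 1)
    (h0 : ∫ ω, f ω ∂μ = 0) (s : Finset ι) {ε : ℝ} (hε : 0 ≤ ε) :
    (Measure.pi fun _ : ι => μ).real {ω | ε ≤ |∑ a ∈ s, f (ω a)|} ≤
      2 * Real.exp (-ε ^ 2 / (2 * s.card)) := by
  have key : ∀ g : Ω → ℝ, Measurable g → (∀ ω, |g ω| ≤ 1) → ∫ ω, g ω ∂μ = 0 →
      (Measure.pi fun _ : ι => μ).real {ω | ε ≤ ∑ a ∈ s, g (ω a)} ≤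
        Real.exp (-ε ^ 2 / (2 * s.card)) := by
    intro g hg hgb hg0
    have hind : iIndepFun (fun (a : ι) (ω : ι → Ω) => g (ω a)) (Measure.pi fun _ : ι => μ) :=
      iIndepFun_pi (X := fun (_ : ι) => g) fun _ => hg.aemeasurable
    have hsub : ∀ a ∈ s, HasSubgaussianMGF (fun ω : ι → Ω => g (ω a)) 1
        (Measure.pi fun _ : ι => μ) := by
      intro a _
      have := hasSubgaussianMGF_of_mem_Icc_of_integral_eq_zero
        (μ := Measure.pi fun _ : ι => μ) (X := fun ω : ι → Ω => g (ω a)) (a := -1) (b := 1)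
        (hg.comp (measurable_pi_apply a)).aemeasurable
        (Filter.Eventually.of_forall fun ω => abs_le.1 (hgb (ω a)))
        (by
          have := integral_comp_eval (μ := fun _ : ι => μ) (i := a) (f := g)
            hg.aestronglyMeasurable
          rw [this, hg0])
      convert this using 1
      ext
      norm_num
    have := HasSubgaussianMGF.measure_sum_ge_le_of_iIndepFun hind hsub hε
    simpa using this
  have hsplit : {ω : ι → Ω | ε ≤ |∑ a ∈ s, f (ω a)|} ⊆
      {ω | ε ≤ ∑ a ∈ s, f (ω a)} ∪ {ω | ε ≤ ∑ a ∈ s, (-f (ω a))} := by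
    intro ω hω
    rw [Set.mem_ofPred_eq, le_abs] at hω
    simpa [Finset.sum_neg_distrib] using hω
  have h1 := key f hf hb h0
  have h2 := key (fun ω => -f ω) hf.neg (by simpa using hb) (by rw [integral_neg, h0, neg_zero])
  calc _ ≤ _ := measureReal_mono hsplit
    _ ≤ _ := measureReal_union_le _ _
    _ ≤ _ := by linarith

end DecSSL
-- The losses as quartic objectives
namespace DecSSL
open Matrix

/-- The empirical second moment matrix of a finite data set. -/
noncomputable def secondMoment {ι : Type} [Fintype ι] {d : ℕ}
    (x : ι → EuclideanSpace ℝ (Fin d)) : Matrix (Fin d) (Fin d) ℝ :=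
  (1 / (Fintype.card ι : ℝ)) • ∑ a, vecMulVec (x a).ofLp (x a).ofLp

lemma isSymm_secondMoment {ι : Type} [Fintype ι] {d : ℕ}
    (x : ι → EuclideanSpace ℝ (Fin d)) : (secondMoment x).IsSymm := by
  unfold secondMoment IsSymm
  rw [transpose_smul, transpose_sum]
  simp only [transpose_vecMulVec]

lemma dotProduct_secondMoment_mulVec {ι : Type} [Fintype ι] {d : ℕ}
    (x : ι → EuclideanSpace ℝ (Fin d)) (v : Fin d → ℝ) :
    v ⬝ᵥ secondMoment x *ᵥ v =
      (1 / (Fintype.card ι : ℝ)) * ∑ a, inner ℝ (WithLp.toLp 2 v) (x a) ^ 2 := by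
  unfold secondMoment
  rw [smul_mulVec, dotProduct_smul, sum_mulVec, dotProduct_sum, smul_eq_mul]
  congr 1
  refine Finset.sum_congr rfl fun a _ => ?_
  rw [vecMulVec_mulVec, EuclideanSpace.inner_eq_star_dotProduct]
  simp [dotProduct_comm v, sq]

/-- Each coordinate contributes a product of two independent factors with the same mean, so the
variance of the augmentation never enters. -/
lemma integral_inner_embed_add {m d : ℕ} (w : Matrix (Fin m) (Fin d) ℝ)
    (x : EuclideanSpace ℝ (Fin d)) :
    ∫ p : EuclideanSpace ℝ (Fin d) × EuclideanSpace ℝ (Fin d),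
        inner ℝ (embed w (x + p.1)) (embed w (x + p.2))
        ∂((stdGaussian (EuclideanSpace ℝ (Fin d))).prod
            (stdGaussian (EuclideanSpace ℝ (Fin d)))) = (w *ᵥ x.ofLp) ⬝ᵥ (w *ᵥ x.ofLp) := by
  set γ := stdGaussian (EuclideanSpace ℝ (Fin d))
  let L : Fin m → StrongDual ℝ (EuclideanSpace ℝ (Fin d)) := fun i =>
    (EuclideanSpace.proj i).comp (LinearMap.toContinuousLinearMap (Matrix.toEuclideanLin w))
  have hL : ∀ i z, L i z = (w *ᵥ z.ofLp) i := fun i z => rfl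
  have hint : ∀ i, Integrable (fun z => L i x + L i z) γ := fun i =>
    (integrable_const _).add ((L i).integrable_comp IsGaussian.integrable_fun_id)
  have hval : ∀ i, ∫ z, (L i x + L i z) ∂γ = L i x := by
    intro i
    rw [integral_add (integrable_const _) ((L i).integrable_comp IsGaussian.integrable_fun_id),
      integral_const]
    have : ∫ z, L i z ∂γ = 0 := integral_strongDual_stdGaussian (L i)
    rw [this]
    simp
  have e : ∀ p : EuclideanSpace ℝ (Fin d) × EuclideanSpace ℝ (Fin d),
      inner ℝ (embed w (x + p.1)) (embed w (x + p.2)) =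
        ∑ i, (L i x + L i p.1) * (L i x + L i p.2) := by
    intro p
    rw [PiLp.inner_apply]
    refine Finset.sum_congr rfl fun i _ => ?_
    rw [← map_add, ← map_add]
    exact mul_comm _ _
  simp_rw [e]
  rw [integral_finsetSum _ fun i _ => (hint i).mul_prod (hint i)]
  refine Finset.sum_congr rfl fun i _ => ?_
  rw [integral_prod_mul (fun z => L i x + L i z) (fun z => L i x + L i z), hval, hL]

lemma localLoss_eq_quarticLoss {ι : Type} [Fintype ι] {m d : ℕ}
    (x : ι → EuclideanSpace ℝ (Fin d)) :
    (localLoss x : Matrix (Fin m) (Fin d) ℝ → ℝ) = quarticLoss (secondMoment x) := by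
  funext w
  unfold localLoss quarticLoss secondMoment
  congr 2
  rw [Matrix.mul_smul, Matrix.smul_mul, trace_smul, smul_eq_mul, Matrix.mul_sum, Matrix.sum_mul,
    trace_sum]
  congr 1
  refine Finset.sum_congr rfl fun a _ => ?_
  rw [integral_inner_embed_add, mul_vecMulVec, vecMulVec_mul, vecMul_transpose, trace_vecMulVec]

lemma globalLoss_eq_quarticLoss {K : ℕ} {ι : Fin K → Type} [∀ k, Fintype (ι k)] {m d : ℕ}
    (x : ∀ k, ι k → EuclideanSpace ℝ (Fin d)) {N : ℕ} (hN : 0 < N) (hK : 0 < K)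
    (hcard : ∀ k, Fintype.card (ι k) = N) :
    (globalLoss x : Matrix (Fin m) (Fin d) ℝ → ℝ) =
      quarticLoss ((1 / (K : ℝ)) • ∑ k, secondMoment (x k)) := by
  funext w
  have hN' : (N : ℝ) ≠ 0 := by positivity
  have hK' : (K : ℝ) ≠ 0 := by positivity
  unfold globalLoss
  simp only [hcard, localLoss_eq_quarticLoss, Finset.sum_const, Finset.card_univ,
    Fintype.card_fin, nsmul_eq_mul]
  have hq : (N : ℝ) / (K * N) = 1 / K := by field_simp
  simp only [hq]
  unfold quarticLoss
  rw [← Finset.mul_sum, Finset.sum_add_distrib, Finset.sum_neg_distrib, Matrix.mul_smul,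
    Matrix.smul_mul, trace_smul, smul_eq_mul, Matrix.mul_sum, Matrix.sum_mul, trace_sum,
    Finset.sum_const, Finset.card_univ, Fintype.card_fin, nsmul_eq_mul]
  field_simp

/-! ### The random signs -/

/-- The `±1` encoding of the bits `q`, with the entry `k` replaced by `1`. -/
def signVec {K : ℕ} (k : Fin K) (q : Fin K → Bool) (i : Fin K) : ℝ :=
  if i = k then 1 else if q i then 1 else -1

lemma signVec_mul_self {K : ℕ} (k : Fin K) (q : Fin K → Bool) (i : Fin K) :
    signVec k q i * signVec k q i = 1 := by
  unfold signVec
  split_ifs <;> norm_num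

lemma abs_signVec {K : ℕ} (k : Fin K) (q : Fin K → Bool) (i : Fin K) :
    |signVec k q i| = 1 := by
  unfold signVec
  split_ifs <;> norm_num

lemma measurable_signVec {K : ℕ} (k i : Fin K) :
    Measurable fun q : Fin K → Bool => signVec k q i := measurable_of_countable _

/-- The law of `K` independent uniform bits. -/
noncomputable abbrev bitsLaw (K : ℕ) : Measure (Fin K → Bool) :=
  Measure.pi fun _ : Fin K => (PMF.uniformOfFintype Bool).toMeasure

lemma measurePreserving_not_uniform :
    MeasurePreserving Bool.not (PMF.uniformOfFintype Bool).toMeasure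
      (PMF.uniformOfFintype Bool).toMeasure := by
  refine ⟨measurable_of_countable _, ?_⟩
  refine Measure.ext_of_singleton fun b => ?_
  rw [Measure.map_apply (measurable_of_countable _) (measurableSet_singleton b)]
  have : Bool.not ⁻¹' {b} = {!b} := by
    ext c
    cases b <;> cases c <;> simp
  rw [this, PMF.toMeasure_apply_singleton _ _ (measurableSet_singleton _),
    PMF.toMeasure_apply_singleton _ _ (measurableSet_singleton _)]
  simp

/-- Flipping the bit `j` preserves the law and changes the sign of the integrand. -/
lemma integral_signVec_mul_signVec {K : ℕ} (k : Fin K) {i j : Fin K} (hij : i ≠ j) (hj : j ≠ k) :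
    ∫ q, signVec k q i * signVec k q j ∂(bitsLaw K) = 0 := by
  let f : Fin K → Bool → Bool := fun l => if l = j then Bool.not else id
  have hmp : MeasurePreserving (fun (q : Fin K → Bool) l => f l (q l)) (bitsLaw K) (bitsLaw K) := by
    refine measurePreserving_pi _ _ fun l => ?_
    by_cases hl : l = j
    · simpa [f, hl] using measurePreserving_not_uniform
    · simpa [f, hl] using MeasurePreserving.id _
  have hm : AEStronglyMeasurable (fun q => signVec k q i * signVec k q j)
      ((bitsLaw K).map fun (q : Fin K → Bool) l => f l (q l)) :=
    (measurable_of_countable _).aestronglyMeasurable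
  have h1 : ∫ q, signVec k q i * signVec k q j ∂(bitsLaw K) =
      ∫ q, -(signVec k q i * signVec k q j) ∂(bitsLaw K) := by
    conv_lhs => rw [← hmp.map_eq]
    rw [integral_map hmp.measurable.aemeasurable hm]
    refine integral_congr_ae (Filter.Eventually.of_forall fun q => ?_)
    simp only [signVec, f, if_neg hij, if_neg hj, if_true]
    cases q j <;> simp
  rw [integral_neg] at h1
  linarith

/-- Nearly orthogonal columns make the Gram form of a sign matrix well conditioned. -/
lemma card_div_two_mul_sum_sq_le {ι : Type*} {K : ℕ} (s : Finset ι) (y : ι → Fin K → ℝ)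
    (hy : ∀ a i, y a i * y a i = 1)
    (h : ∀ i j, i ≠ j → |∑ a ∈ s, y a i * y a j| ≤ s.card / (2 * K)) (u : Fin K → ℝ) :
    s.card / 2 * ∑ i, u i ^ 2 ≤ ∑ a ∈ s, (∑ i, y a i * u i) ^ 2 := by
  have e : ∑ a ∈ s, (∑ i, y a i * u i) ^ 2 =
      ∑ i, ∑ j, (∑ a ∈ s, y a i * y a j) * (u i * u j) := by
    have h1 : ∀ a, (∑ i, y a i * u i) ^ 2 = ∑ i, ∑ j, y a i * y a j * (u i * u j) := by
      intro a
      rw [sq, Finset.sum_mul_sum]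
      exact Finset.sum_congr rfl fun i _ => Finset.sum_congr rfl fun j _ => by ring
    simp only [h1, Finset.sum_mul]
    rw [Finset.sum_comm]
    exact Finset.sum_congr rfl fun i _ => Finset.sum_comm
  -- Each off-diagonal entry is charged half to `u i ^ 2` and half to `u j ^ 2`. Over all pairs the
  -- total charge is `s.card / 2 * ∑ u i ^ 2`, half of the diagonal.
  have hterm : ∀ i j, (if i = j then (s.card : ℝ) * u i ^ 2 else 0)
      - s.card / (2 * K) * ((u i ^ 2 + u j ^ 2) / 2) ≤
      (∑ a ∈ s, y a i * y a j) * (u i * u j) := by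
    intro i j
    have hpos : 0 ≤ (s.card : ℝ) / (2 * K) := by positivity
    by_cases hij : i = j
    · subst hij
      simp only [hy, if_true, Finset.sum_const, nsmul_eq_mul, mul_one]
      nlinarith [mul_nonneg hpos (sq_nonneg (u i))]
    · rw [if_neg hij, zero_sub]
      have h1 := h i j hij
      have h2 : |u i * u j| ≤ (u i ^ 2 + u j ^ 2) / 2 := by
        rw [abs_le]
        constructor <;> nlinarith [sq_nonneg (u i + u j), sq_nonneg (u i - u j)]
      have h3 : |(∑ a ∈ s, y a i * y a j) * (u i * u j)| ≤
          s.card / (2 * K) * ((u i ^ 2 + u j ^ 2) / 2) := by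
        rw [abs_mul]
        exact mul_le_mul h1 h2 (abs_nonneg _) hpos
      exact (abs_le.1 h3).1
  rw [e]
  refine le_trans ?_ (Finset.sum_le_sum fun i _ => Finset.sum_le_sum fun j _ => hterm i j)
  simp only [Finset.sum_sub_distrib, Finset.sum_ite_eq, Finset.mem_univ, if_true,
    ← Finset.mul_sum, ← Finset.sum_div, Finset.sum_add_distrib, Finset.sum_const,
    Finset.card_univ, Fintype.card_fin, nsmul_eq_mul]
  rcases Nat.eq_zero_or_pos K with hK | hK
  · subst hK
    simp
  · have hK' : (K : ℝ) ≠ 0 := by positivity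
    apply le_of_eq
    field_simp
    ring

end DecSSL
-- Bits and noise behind the data, and the good event
namespace DecSSL
open Matrix

/-- The joint law of the bits and of the noise of a single data point. -/
noncomputable abbrev latentLaw (K d : ℕ) :
    Measure ((Fin K → Bool) × EuclideanSpace ℝ (Fin d)) :=
  (bitsLaw K).prod (stdGaussian (EuclideanSpace ℝ (Fin d)))

/-- A data point of source `k` as a function of its bits and its noise. -/
noncomputable def latentPoint {K d : ℕ} (hKd : K ≤ d) (n r : Fin K → ℕ) (k : Fin K) :
    SampleIdx n r k → (Fin K → Bool) × EuclideanSpace ℝ (Fin d) → EuclideanSpace ℝ (Fin d)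
  | Sum.inl a => fun p =>
      (if a.1 then (1 : ℝ) else -1) • basisVec hKd k
        - ∑ i ∈ Finset.univ.erase k,
            ((if p.1 i then (1 : ℝ) else 0) * (d : ℝ) ^ (1 / 5 : ℝ)) • basisVec hKd i
        + ((d : ℝ) ^ (-(1 / 5) : ℝ)) • p.2
  | Sum.inr b => fun p => basisVec hKd b.1.1 + ((d : ℝ) ^ (-(1 / 5) : ℝ)) • p.2

variable {K d : ℕ} (hKd : K ≤ d) (n r : Fin K → ℕ) (k : Fin K)

lemma measurable_latentPoint (a : SampleIdx n r k) : Measurable (latentPoint hKd n r k a) := by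
  have hbit : ∀ i : Fin K, Measurable fun p : (Fin K → Bool) × EuclideanSpace ℝ (Fin d) =>
      (if p.1 i then (1 : ℝ) else 0) := fun i =>
    (measurable_of_countable fun b : Bool => if b then (1 : ℝ) else 0).comp
      ((measurable_pi_apply i).comp measurable_fst)
  cases a <;> unfold latentPoint <;> fun_prop

lemma map_latentPoint (a : SampleIdx n r k) :
    (latentLaw K d).map (latentPoint hKd n r k a) = sampleLaw hKd n r k a := by
  cases a with
  | inl a => rfl
  | inr b =>
    change (latentLaw K d).map
        (fun p => basisVec hKd b.1.1 + ((d : ℝ) ^ (-(1 / 5) : ℝ)) • p.2) =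
      (stdGaussian (EuclideanSpace ℝ (Fin d))).map
        fun z => basisVec hKd b.1.1 + ((d : ℝ) ^ (-(1 / 5) : ℝ)) • z
    have hsnd : (latentLaw K d).map Prod.snd = stdGaussian (EuclideanSpace ℝ (Fin d)) :=
      measurePreserving_snd.map_eq
    conv_rhs => rw [← hsnd]
    rw [Measure.map_map (by fun_prop) measurable_snd]
    rfl

/-- Minority points also receive bits, which they ignore. All points then have the same latent law,
so the noise of the whole data set is a single Gaussian matrix. -/
lemma pi_sampleLaw_eq_map :
    Measure.pi (fun a => sampleLaw hKd n r k a) =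
      (Measure.pi fun _ : SampleIdx n r k => latentLaw K d).map
        fun ω a => latentPoint hKd n r k a (ω a) := by
  have : ∀ a : SampleIdx n r k,
      IsProbabilityMeasure ((latentLaw K d).map (latentPoint hKd n r k a)) := fun a =>
    Measure.isProbabilityMeasure_map (measurable_latentPoint hKd n r k a).aemeasurable
  rw [Measure.pi_map_pi fun a => (measurable_latentPoint hKd n r k a).aemeasurable]
  simp only [map_latentPoint]

/-- The quadratic form of the data of source `k` is small off the first `K` coordinates and large
on the coordinates `i ≠ k` with `i < K`. -/
def IsWellSpread (B : ℝ) (x : SampleIdx n r k → EuclideanSpace ℝ (Fin d)) : Prop :=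
  (∀ v : EuclideanSpace ℝ (Fin d), (∀ i : Fin K, v (Fin.castLE hKd i) = 0) →
    ∑ a, inner ℝ v (x a) ^ 2 ≤ ((d : ℝ) ^ (-(1 / 5) : ℝ)) ^ 2 * (B * ‖v‖ ^ 2)) ∧
  ∀ v : EuclideanSpace ℝ (Fin d), ∀ i : Fin K, i ≠ k →
    n k * ((d : ℝ) ^ (1 / 5 : ℝ)) ^ 2 / 16 * v (Fin.castLE hKd i) ^ 2 ≤
      ∑ a, inner ℝ v (x a) ^ 2 + ((d : ℝ) ^ (-(1 / 5) : ℝ)) ^ 2 * (B * ‖v‖ ^ 2)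

/-- Closedness yields measurability although the event quantifies over uncountably many `v`. -/
lemma isClosed_setOf_isWellSpread (B : ℝ) :
    IsClosed {x : SampleIdx n r k → EuclideanSpace ℝ (Fin d) | IsWellSpread hKd n r k B x} := by
  unfold IsWellSpread
  simp only [Set.ofPred_and, Set.ofPred_forall]
  refine IsClosed.inter ?_ ?_
  · exact isClosed_iInter fun v => isClosed_iInter fun _ =>
      isClosed_le (by fun_prop) continuous_const
  · exact isClosed_iInter fun v => isClosed_iInter fun i => isClosed_iInter fun _ =>
      isClosed_le continuous_const (by fun_prop)

lemma inner_basisVec (v : EuclideanSpace ℝ (Fin d)) (i : Fin K) :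
    inner ℝ v (basisVec hKd i) = v (Fin.castLE hKd i) := by
  unfold basisVec
  rw [EuclideanSpace.inner_single_right]
  simp

/-- The points of class `2k-1` in source `k`. -/
def positiveIdx : Finset (SampleIdx n r k) :=
  Finset.univ.map
    ⟨fun t : Fin (n k) => Sum.inl (true, t), fun s t h => by simpa using h⟩

lemma card_positiveIdx : (positiveIdx n r k).card = n k := by simp [positiveIdx]

/-- A bit is `(1 + sign) / 2`. The nonzero means of the bits are collected in the coefficient of the
constant sign at `k`, which turns the point into a linear form in signs that are orthogonal in mean.
-/
lemma inner_latentPoint_of_mem_positiveIdx {a : SampleIdx n r k} (ha : a ∈ positiveIdx n r k)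
    (v : EuclideanSpace ℝ (Fin d)) (p : (Fin K → Bool) × EuclideanSpace ℝ (Fin d)) :
    inner ℝ v (latentPoint hKd n r k a p) =
      ∑ i, signVec k p.1 i *
        (if i = k then v (Fin.castLE hKd k) - (d : ℝ) ^ (1 / 5 : ℝ) / 2 *
            ∑ j ∈ Finset.univ.erase k, v (Fin.castLE hKd j)
          else -((d : ℝ) ^ (1 / 5 : ℝ) / 2 * v (Fin.castLE hKd i)))
      + (d : ℝ) ^ (-(1 / 5) : ℝ) * inner ℝ v p.2 := by
  obtain ⟨t, -, rfl⟩ := Finset.mem_map.1 ha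
  change inner ℝ v ((1 : ℝ) • basisVec hKd k
        - ∑ i ∈ Finset.univ.erase k,
            ((if p.1 i then (1 : ℝ) else 0) * (d : ℝ) ^ (1 / 5 : ℝ)) • basisVec hKd i
        + ((d : ℝ) ^ (-(1 / 5) : ℝ)) • p.2) = _
  simp only [one_smul, inner_add_right, inner_sub_right, inner_sum, real_inner_smul_right,
    inner_basisVec]
  congr 1
  rw [← Finset.add_sum_erase _ _ (Finset.mem_univ k), if_pos rfl, signVec, if_pos rfl, one_mul,
    sub_add, Finset.mul_sum, ← Finset.sum_sub_distrib]
  congr 1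
  refine Finset.sum_congr rfl fun i hi => ?_
  have hik : i ≠ k := Finset.ne_of_mem_erase hi
  rw [if_neg hik, signVec, if_neg hik]
  split_ifs <;> ring

/-- The first `K` coordinates of `v` vanish in the upper bound, so only noise survives. For the
lower bound the class `2k-1` alone suffices: the Gram bound gives `n k / 2 * (τ v_i / 2)²`, and
separating the noise costs another factor `1/2`, whence the `16`. -/
lemma isWellSpread_latentPoint {B : ℝ}
    (ω : SampleIdx n r k → (Fin K → Bool) × EuclideanSpace ℝ (Fin d))
    (hnoise : ∀ v : EuclideanSpace ℝ (Fin d), ∑ a, inner ℝ v (ω a).2 ^ 2 ≤ B * ‖v‖ ^ 2)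
    (hsign : ∀ i j, i ≠ j →
      |∑ a ∈ positiveIdx n r k, signVec k (ω a).1 i * signVec k (ω a).1 j| ≤ n k / (2 * K)) :
    IsWellSpread hKd n r k B fun a => latentPoint hKd n r k a (ω a) := by
  set μ : ℝ := (d : ℝ) ^ (-(1 / 5) : ℝ) with hμ
  set τ : ℝ := (d : ℝ) ^ (1 / 5 : ℝ) with hτ
  refine ⟨fun v hv => ?_, fun v i hi => ?_⟩
  · have e : ∀ a, inner ℝ v (latentPoint hKd n r k a (ω a)) = μ * inner ℝ v (ω a).2 := by
      intro a
      cases a <;> simp only [latentPoint, inner_add_right, inner_sub_right, inner_sum,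
        real_inner_smul_right, inner_basisVec, hv, mul_zero, Finset.sum_const_zero, sub_zero,
        zero_add, hμ]
    simp only [e, mul_pow, ← Finset.mul_sum]
    exact mul_le_mul_of_nonneg_left (hnoise v) (sq_nonneg _)
  · set u : Fin K → ℝ := fun i =>
        (if i = k then v (Fin.castLE hKd k) - τ / 2 *
            ∑ j ∈ Finset.univ.erase k, v (Fin.castLE hKd j)
          else -(τ / 2 * v (Fin.castLE hKd i))) with hu
    have hgram := card_div_two_mul_sum_sq_le (positiveIdx n r k)
      (fun a i => signVec k (ω a).1 i) (fun a i => signVec_mul_self k _ i)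
      (by simpa only [card_positiveIdx] using hsign) u
    rw [card_positiveIdx] at hgram
    have hui : (τ / 2 * v (Fin.castLE hKd i)) ^ 2 ≤ ∑ i, u i ^ 2 := by
      have := Finset.single_le_sum (f := fun i => u i ^ 2) (fun _ _ => sq_nonneg _)
        (Finset.mem_univ i)
      refine le_trans (le_of_eq ?_) this
      simp only [hu, if_neg hi]
      ring
    have hpt : ∀ a ∈ positiveIdx n r k, (1 / 2) * (∑ i, signVec k (ω a).1 i * u i) ^ 2 ≤
        inner ℝ v (latentPoint hKd n r k a (ω a)) ^ 2 + μ ^ 2 * inner ℝ v (ω a).2 ^ 2 := by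
      intro a ha
      rw [inner_latentPoint_of_mem_positiveIdx hKd n r k ha]
      -- This is `(a + b)² ≥ a² / 2 - b²`, the difference of the two sides being `(a + 2b)² / 2`.
      nlinarith [sq_nonneg (∑ i, signVec k (ω a).1 i * u i + 2 * (μ * inner ℝ v (ω a).2))]
    have hsum := Finset.sum_le_sum hpt
    rw [← Finset.mul_sum] at hsum
    have hall : ∑ a ∈ positiveIdx n r k,
          (inner ℝ v (latentPoint hKd n r k a (ω a)) ^ 2 + μ ^ 2 * inner ℝ v (ω a).2 ^ 2) ≤
        ∑ a, (inner ℝ v (latentPoint hKd n r k a (ω a)) ^ 2 + μ ^ 2 * inner ℝ v (ω a).2 ^ 2) :=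
      Finset.sum_le_sum_of_subset_of_nonneg (Finset.subset_univ _) fun _ _ _ => by positivity
    rw [Finset.sum_add_distrib (s := Finset.univ), ← Finset.mul_sum] at hall
    have hn := mul_le_mul_of_nonneg_left (hnoise v) (sq_nonneg μ)
    have hnk : (0 : ℝ) ≤ n k := Nat.cast_nonneg _
    have h1 := mul_le_mul_of_nonneg_left hui (by positivity : (0 : ℝ) ≤ n k / 4)
    calc n k * τ ^ 2 / 16 * v (Fin.castLE hKd i) ^ 2
        = n k / 4 * (τ / 2 * v (Fin.castLE hKd i)) ^ 2 := by ring
      _ ≤ _ := by linarith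

lemma measureReal_le_abs_sum_signVec_le {i j : Fin K} (hij : i ≠ j) :
    (Measure.pi fun _ : SampleIdx n r k => latentLaw K d).real
      {ω | n k / (2 * K : ℝ) ≤
        |∑ a ∈ positiveIdx n r k, signVec k (ω a).1 i * signVec k (ω a).1 j|} ≤
      2 * Real.exp (-(n k / (8 * (K : ℝ) ^ 2))) := by
  have h0 : ∫ p, signVec k p.1 i * signVec k p.1 j ∂(latentLaw K d) = 0 := by
    rw [integral_fun_fst (fun q => signVec k q i * signVec k q j)]
    by_cases hj : j = k
    · have hi : i ≠ k := fun h => hij (h.trans hj.symm)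
      simp_rw [mul_comm (signVec k _ i)]
      rw [integral_signVec_mul_signVec k hij.symm hi, smul_zero]
    · rw [integral_signVec_mul_signVec k hij hj, smul_zero]
  have hm : Measurable fun p : (Fin K → Bool) × EuclideanSpace ℝ (Fin d) =>
      signVec k p.1 i * signVec k p.1 j :=
    ((measurable_signVec k i).comp measurable_fst).mul
      ((measurable_signVec k j).comp measurable_fst)
  have := measureReal_le_abs_sum_le (latentLaw K d) hm
    (fun p => by rw [abs_mul, abs_signVec, abs_signVec, one_mul]) h0 (positiveIdx n r k)
    (ε := n k / (2 * K : ℝ)) (by positivity)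
  refine this.trans_eq ?_
  rw [card_positiveIdx]
  congr 2
  have hK : (K : ℝ) ≠ 0 := by
    have : 0 < K := Fin.pos k
    positivity
  rcases Nat.eq_zero_or_pos (n k) with hn | hn
  · simp [hn]
  · field_simp
    norm_num

lemma measureReal_not_isWellSpread_le (B : ℝ) :
    (Measure.pi fun a => sampleLaw hKd n r k a).real {x | IsWellSpread hKd n r k B x}ᶜ ≤
      2 ^ (d + Fintype.card (SampleIdx n r k)) * Real.exp (-(B / 16)) +
        K ^ 2 * (2 * Real.exp (-(n k / (8 * (K : ℝ) ^ 2)))) := by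
  set P := Measure.pi fun _ : SampleIdx n r k => latentLaw K d with hP
  have hmeas : Measurable fun (ω : SampleIdx n r k → (Fin K → Bool) × EuclideanSpace ℝ (Fin d)) a =>
      latentPoint hKd n r k a (ω a) :=
    measurable_pi_lambda _ fun a =>
      (measurable_latentPoint hKd n r k a).comp (measurable_pi_apply a)
  rw [pi_sampleLaw_eq_map, map_measureReal_apply hmeas
    (isClosed_setOf_isWellSpread hKd n r k B).measurableSet.compl]
  set S : Set (SampleIdx n r k → EuclideanSpace ℝ (Fin d)) :=
    {ξ | ∃ v, B * ‖v‖ ^ 2 < ∑ a, inner ℝ v (ξ a) ^ 2} with hS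
  have hSmeas : MeasurableSet S := by
    simp only [hS, Set.ofPred_exists]
    exact (isOpen_iUnion fun v => isOpen_lt continuous_const (by fun_prop)).measurableSet
  have hnoise : P.real {ω | (fun a => (ω a).2) ∈ S} ≤
      2 ^ (d + Fintype.card (SampleIdx n r k)) * Real.exp (-(B / 16)) := by
    have hmp : MeasurePreserving
        (fun (ω : SampleIdx n r k → (Fin K → Bool) × EuclideanSpace ℝ (Fin d)) a => (ω a).2) P
        (Measure.pi fun _ => stdGaussian (EuclideanSpace ℝ (Fin d))) :=
      measurePreserving_pi _ _ fun _ => measurePreserving_snd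
    have h1 := measure_exists_lt_sum_inner_sq_le (E := EuclideanSpace ℝ (Fin d))
      (ι := SampleIdx n r k) (B := B)
    rw [finrank_euclideanSpace_fin] at h1
    rw [measureReal_def]
    refine ENNReal.toReal_le_of_le_ofReal (by positivity) ?_
    exact (hmp.measure_preimage hSmeas.nullMeasurableSet).trans_le h1
  let T : Fin K × Fin K → Set (SampleIdx n r k → (Fin K → Bool) × EuclideanSpace ℝ (Fin d)) :=
    fun q => {ω | q.1 ≠ q.2 ∧ n k / (2 * K : ℝ) ≤
      |∑ a ∈ positiveIdx n r k, signVec k (ω a).1 q.1 * signVec k (ω a).1 q.2|}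
  have hT : ∀ q, P.real (T q) ≤ 2 * Real.exp (-(n k / (8 * (K : ℝ) ^ 2))) := by
    intro q
    by_cases hq : q.1 = q.2
    · have : T q = ∅ := by
        ext ω
        simp [T, hq]
      rw [this, measureReal_empty]
      positivity
    · refine le_trans (measureReal_mono fun ω hω => ?_)
        (measureReal_le_abs_sum_signVec_le n r k hq)
      exact hω.2
  have hsub : (fun ω a => latentPoint hKd n r k a (ω a)) ⁻¹'
      {x | IsWellSpread hKd n r k B x}ᶜ ⊆
      {ω | (fun a => (ω a).2) ∈ S} ∪ ⋃ q ∈ (Finset.univ : Finset (Fin K × Fin K)), T q := by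
    intro ω hω
    by_contra hc
    rw [Set.mem_union, not_or] at hc
    obtain ⟨h1, h2⟩ := hc
    refine hω (isWellSpread_latentPoint hKd n r k ω (fun v => ?_) fun i j hij => ?_)
    · by_contra! hlt
      exact h1 ⟨v, hlt⟩
    · by_contra! hlt
      exact h2 (Set.mem_biUnion (Finset.mem_coe.2 (Finset.mem_univ (i, j))) ⟨hij, hlt.le⟩)
  calc _ ≤ _ := measureReal_mono hsub
    _ ≤ _ := measureReal_union_le _ _
    _ ≤ _ := add_le_add hnoise ((measureReal_biUnion_finset_le _ _).trans
        (Finset.sum_le_sum fun q _ => hT q))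
    _ = _ := by
        rw [Finset.sum_const, Finset.card_univ, Fintype.card_prod, Fintype.card_fin, nsmul_eq_mul]
        push_cast
        ring

end DecSSL
-- Quadratic form bounds on the good event, and its probability
namespace DecSSL
open Matrix

lemma dotProduct_self_eq_norm_sq {d : ℕ} (v : Fin d → ℝ) :
    v ⬝ᵥ v = ‖(WithLp.toLp 2 v : EuclideanSpace ℝ (Fin d))‖ ^ 2 := by
  rw [EuclideanSpace.real_norm_sq_eq]
  simp [dotProduct, sq]

lemma dotProduct_secondMoment_mulVec_nonneg {ι : Type} [Fintype ι] {d : ℕ}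
    (x : ι → EuclideanSpace ℝ (Fin d)) (v : Fin d → ℝ) : 0 ≤ v ⬝ᵥ secondMoment x *ᵥ v := by
  rw [dotProduct_secondMoment_mulVec]
  positivity

section WellSpread

variable {K d : ℕ} {hKd : K ≤ d} {n r : Fin K → ℕ} {k : Fin K} {b : ℝ}
  {x : SampleIdx n r k → EuclideanSpace ℝ (Fin d)}

lemma IsWellSpread.quadForm_le
    (hx : IsWellSpread hKd n r k (b * Fintype.card (SampleIdx n r k)) x)
    (hN : 0 < Fintype.card (SampleIdx n r k)) (v : Fin d → ℝ)
    (hv : ∀ i : Fin K, v (Fin.castLE hKd i) = 0) :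
    v ⬝ᵥ secondMoment x *ᵥ v ≤ ((d : ℝ) ^ (-(1 / 5) : ℝ)) ^ 2 * b * (v ⬝ᵥ v) := by
  have hN' : (0 : ℝ) < Fintype.card (SampleIdx n r k) := by exact_mod_cast hN
  have h := hx.1 (WithLp.toLp 2 v) hv
  rw [dotProduct_secondMoment_mulVec, dotProduct_self_eq_norm_sq, div_mul_eq_mul_div, one_mul,
    div_le_iff₀ hN']
  linarith

lemma IsWellSpread.le_quadForm
    (hx : IsWellSpread hKd n r k (b * Fintype.card (SampleIdx n r k)) x)
    (hN : 0 < Fintype.card (SampleIdx n r k)) {c : ℝ} (hc : 0 < c)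
    (hcard : (Fintype.card (SampleIdx n r k) : ℝ) ≤ c * n k) (v : Fin d → ℝ)
    {i : Fin K} (hi : i ≠ k) :
    ((d : ℝ) ^ (1 / 5 : ℝ)) ^ 2 / (16 * c) * v (Fin.castLE hKd i) ^ 2 ≤
      v ⬝ᵥ secondMoment x *ᵥ v + ((d : ℝ) ^ (-(1 / 5) : ℝ)) ^ 2 * b * (v ⬝ᵥ v) := by
  have hN' : (0 : ℝ) < Fintype.card (SampleIdx n r k) := by exact_mod_cast hN
  have h := hx.2 (WithLp.toLp 2 v) i hi
  rw [dotProduct_secondMoment_mulVec, dotProduct_self_eq_norm_sq]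
  set N : ℝ := (Fintype.card (SampleIdx n r k) : ℝ)
  have h1 : ((d : ℝ) ^ (1 / 5 : ℝ)) ^ 2 / (16 * c) * v (Fin.castLE hKd i) ^ 2 * N ≤
      n k * ((d : ℝ) ^ (1 / 5 : ℝ)) ^ 2 / 16 * v (Fin.castLE hKd i) ^ 2 := by
    calc ((d : ℝ) ^ (1 / 5 : ℝ)) ^ 2 / (16 * c) * v (Fin.castLE hKd i) ^ 2 * N
        ≤ ((d : ℝ) ^ (1 / 5 : ℝ)) ^ 2 / (16 * c) * v (Fin.castLE hKd i) ^ 2 * (c * n k) :=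
          mul_le_mul_of_nonneg_left hcard (by positivity)
      _ = _ := by field_simp
  refine le_of_mul_le_mul_right (h1.trans (h.trans (le_of_eq ?_))) hN'
  field_simp

end WellSpread

lemma isSymm_average {K d : ℕ} {A : Fin K → Matrix (Fin d) (Fin d) ℝ} (hA : ∀ k, (A k).IsSymm) :
    ((1 / (K : ℝ)) • ∑ k, A k).IsSymm := by
  unfold IsSymm
  rw [transpose_smul, transpose_sum]
  simp only [(hA _).eq]

lemma dotProduct_average_mulVec {K d : ℕ} (A : Fin K → Matrix (Fin d) (Fin d) ℝ)
    (v : Fin d → ℝ) :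
    v ⬝ᵥ ((1 / (K : ℝ)) • ∑ k, A k) *ᵥ v = (1 / (K : ℝ)) * ∑ k, v ⬝ᵥ A k *ᵥ v := by
  rw [smul_mulVec, dotProduct_smul, sum_mulVec, dotProduct_sum, smul_eq_mul]

lemma quadForm_average_le {K d : ℕ} (hK : 0 < K) {A : Fin K → Matrix (Fin d) (Fin d) ℝ}
    {v : Fin d → ℝ} {M : ℝ} (h : ∀ k, v ⬝ᵥ A k *ᵥ v ≤ M) :
    v ⬝ᵥ ((1 / (K : ℝ)) • ∑ k, A k) *ᵥ v ≤ M := by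
  have hK' : (0 : ℝ) < K := by exact_mod_cast hK
  rw [dotProduct_average_mulVec, div_mul_eq_mul_div, one_mul, div_le_iff₀ hK']
  refine (Finset.sum_le_sum fun k _ => h k).trans_eq ?_
  simp [mul_comm]

/-- Source `i` itself gives no lower bound beyond nonnegativity; the other `K - 1` sources do, and
`(K - 1) / K ≥ 1/2`. -/
lemma half_mul_le_quadForm_average {K d : ℕ} (hK : 2 ≤ K)
    {A : Fin K → Matrix (Fin d) (Fin d) ℝ} {v : Fin d → ℝ} (i : Fin K) {s M : ℝ} (hs : 0 ≤ s)
    (hM : 0 ≤ M) (hA : 0 ≤ v ⬝ᵥ A i *ᵥ v) (h : ∀ k, i ≠ k → s ≤ v ⬝ᵥ A k *ᵥ v + M) :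
    s / 2 ≤ v ⬝ᵥ ((1 / (K : ℝ)) • ∑ k, A k) *ᵥ v + M := by
  have hK' : (2 : ℝ) ≤ K := by exact_mod_cast hK
  have h1 : ∑ k : Fin K, (if i = k then 0 else s) ≤ ∑ k, (v ⬝ᵥ A k *ᵥ v + M) := by
    refine Finset.sum_le_sum fun k _ => ?_
    split_ifs with hk
    · subst hk
      linarith
    · exact h k hk
  have h2 : ∑ k : Fin K, (if i = k then 0 else s) = K * s - s := by
    have : ∀ k : Fin K, (if i = k then 0 else s) = s - if i = k then s else 0 := fun k => by
      split_ifs <;> simp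
    simp [this]
  rw [h2, Finset.sum_add_distrib, Finset.sum_const, Finset.card_univ, Fintype.card_fin,
    nsmul_eq_mul] at h1
  rw [dotProduct_average_mulVec, div_mul_eq_mul_div, one_mul, ← sub_nonneg]
  have h3 : 0 ≤ (∑ k, v ⬝ᵥ A k *ᵥ v + K * M - K * (s / 2)) / K := by
    apply div_nonneg _ (by linarith)
    nlinarith
  calc 0 ≤ _ := h3
    _ = _ := by field_simp

lemma card_sampleIdx_le {K : ℕ} (n r : Fin K → ℕ) (k : Fin K) :
    Fintype.card (SampleIdx n r k) ≤ 2 * n k + K * r k := by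
  rw [Fintype.card_sum, Fintype.card_prod, Fintype.card_prod, Fintype.card_bool, Fintype.card_fin,
    Fintype.card_fin]
  have := Fintype.card_subtype_le fun i : Fin K => i ≠ k
  rw [Fintype.card_fin] at this
  gcongr

lemma le_card_sampleIdx {K : ℕ} (n r : Fin K → ℕ) (k : Fin K) :
    n k ≤ Fintype.card (SampleIdx n r k) := by
  rw [Fintype.card_sum, Fintype.card_prod, Fintype.card_bool, Fintype.card_fin]
  omega

lemma measureReal_dataLaw_forall_isWellSpread_ge {K d : ℕ} (hKd : K ≤ d) (n r : Fin K → ℕ)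
    (B : Fin K → ℝ) {p : ℝ}
    (h : ∀ k, (Measure.pi fun a => sampleLaw hKd n r k a).real
      {x | IsWellSpread hKd n r k (B k) x}ᶜ ≤ p) :
    1 - K * p ≤ (dataLaw hKd n r).real {x | ∀ k, IsWellSpread hKd n r k (B k) (x k)} := by
  have hm : ∀ k, MeasurableSet {x | IsWellSpread hKd n r k (B k) x} := fun k =>
    (isClosed_setOf_isWellSpread hKd n r k (B k)).measurableSet
  have hE : {x : ∀ k, SampleIdx n r k → EuclideanSpace ℝ (Fin d) |
      ∀ k, IsWellSpread hKd n r k (B k) (x k)} =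
      (⋃ k ∈ (Finset.univ : Finset (Fin K)),
        Function.eval k ⁻¹' {x | IsWellSpread hKd n r k (B k) x}ᶜ)ᶜ := by
    ext x
    simp
  have hU : MeasurableSet (⋃ k ∈ (Finset.univ : Finset (Fin K)),
      (Function.eval k : (∀ k, SampleIdx n r k → EuclideanSpace ℝ (Fin d)) → _) ⁻¹'
        {x | IsWellSpread hKd n r k (B k) x}ᶜ) :=
    Finset.measurableSet_biUnion _ fun k _ => measurable_pi_apply k (hm k).compl
  rw [hE, probReal_compl_eq_one_sub hU]
  refine sub_le_sub_left ((measureReal_biUnion_finset_le _ _).trans ?_) 1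
  have h1 : ∀ k, (dataLaw hKd n r).real
      (Function.eval k ⁻¹' {x | IsWellSpread hKd n r k (B k) x}ᶜ) ≤ p := by
    intro k
    have hmp := measurePreserving_eval
      (fun k => Measure.pi fun a => sampleLaw hKd n r k a) k
    rw [measureReal_def]
    unfold dataLaw
    rw [hmp.measure_preimage (hm k).compl.nullMeasurableSet]
    exact h k
  refine (Finset.sum_le_sum fun k _ => h1 k).trans_eq ?_
  simp

/-- The union bound beats `exp (-d^{1/10})` for large `d`. -/
lemma eventually_failure_bound_le {c₂ c₃ : ℝ} (hc₂ : 0 < c₂) (hc₃ : 0 < c₃) :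
    ∀ᶠ d : ℕ in Filter.atTop, ∀ K : ℕ, 0 < K → K ≤ d → (K : ℝ) ≤ c₂ * (d : ℝ) ^ (1 / 20 : ℝ) →
      K * (Real.exp (-d) + K ^ 2 * (2 * Real.exp (-(c₃ * d / (8 * (K : ℝ) ^ 2))))) ≤
        Real.exp (-(d : ℝ) ^ (1 / 10 : ℝ)) := by
  -- In terms of `y = d^{1/10}` one has `d = y^10` and `K² ≤ c₂² y`, so both exponents exceed `2y`
  -- for large `y`. The prefactor is at most `3 y^30`, absorbed by one of the two factors `exp
  -- (-y)`.
  have hy : Filter.Tendsto (fun d : ℕ => (d : ℝ) ^ (1 / 10 : ℝ)) Filter.atTop Filter.atTop :=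
    (tendsto_rpow_atTop (by norm_num)).comp tendsto_natCast_atTop_atTop
  have hexp : ∀ᶠ y : ℝ in Filter.atTop, y ^ 30 * Real.exp (-y) < 1 / 3 :=
    (Real.tendsto_pow_mul_exp_neg_atTop_nhds_zero 30).eventually_lt_const (by norm_num)
  filter_upwards [hy.eventually hexp, hy.eventually_ge_atTop 2,
    hy.eventually_ge_atTop (2 / (c₃ / (8 * c₂ ^ 2)))] with d h1 h2 h3 K hK hKd hKc
  set y : ℝ := (d : ℝ) ^ (1 / 10 : ℝ) with hydef
  have hdy : (d : ℝ) = y ^ 10 := by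
    rw [hydef, ← Real.rpow_natCast, ← Real.rpow_mul (Nat.cast_nonneg d)]
    norm_num
  have hsq : ((d : ℝ) ^ (1 / 20 : ℝ)) ^ 2 = y := by
    rw [hydef, ← Real.rpow_natCast, ← Real.rpow_mul (Nat.cast_nonneg d)]
    norm_num
  have hK0 : (0 : ℝ) < K := by exact_mod_cast hK
  have hKy : (K : ℝ) ≤ y ^ 10 := by
    rw [← hdy]
    exact_mod_cast hKd
  have hK2 : (K : ℝ) ^ 2 ≤ c₂ ^ 2 * y := by
    rw [← hsq, ← mul_pow]
    exact pow_le_pow_left₀ hK0.le hKc 2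
  have hy1 : (1 : ℝ) ≤ y := by linarith
  have hyp : ∀ m : ℕ, (1 : ℝ) ≤ y ^ m := fun m => one_le_pow₀ hy1
  have e1 : Real.exp (-(d : ℝ)) ≤ Real.exp (-(2 * y)) := by
    refine Real.exp_le_exp.2 (neg_le_neg ?_)
    rw [hdy]
    nlinarith [hyp 8, mul_le_mul_of_nonneg_left (hyp 8) (by positivity : (0 : ℝ) ≤ y * y)]
  have e2 : Real.exp (-(c₃ * d / (8 * (K : ℝ) ^ 2))) ≤ Real.exp (-(2 * y)) := by
    refine Real.exp_le_exp.2 (neg_le_neg ?_)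
    set c : ℝ := c₃ / (8 * c₂ ^ 2) with hc
    have hcpos : 0 < c := by positivity
    rw [div_le_iff₀ hcpos] at h3
    calc 2 * y ≤ y * c * y := by nlinarith
      _ ≤ c * y ^ 9 := by
          nlinarith [mul_le_mul_of_nonneg_left (hyp 7) (by positivity : (0 : ℝ) ≤ c * y ^ 2)]
      _ = c₃ * d / (8 * (c₂ ^ 2 * y)) := by
          rw [hc, hdy]
          field_simp
      _ ≤ c₃ * d / (8 * (K : ℝ) ^ 2) := by
          have : 0 < (K : ℝ) ^ 2 := by positivity
          gcongr
  calc K * (Real.exp (-d) + K ^ 2 * (2 * Real.exp (-(c₃ * d / (8 * (K : ℝ) ^ 2)))))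
      ≤ y ^ 10 * (Real.exp (-(2 * y)) + (y ^ 10) ^ 2 * (2 * Real.exp (-(2 * y)))) := by gcongr
    _ ≤ 3 * (y ^ 30 * Real.exp (-(2 * y))) := by
        have : y ^ 10 ≤ y ^ 30 := pow_le_pow_right₀ hy1 (by norm_num)
        have := mul_le_mul_of_nonneg_right this (Real.exp_pos (-(2 * y))).le
        nlinarith
    _ = 3 * (y ^ 30 * Real.exp (-y)) * Real.exp (-y) := by
        rw [show -(2 * y) = -y + -y by ring, Real.exp_add]
        ring
    _ ≤ 1 * Real.exp (-y) := by
        gcongr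
        linarith
    _ = _ := one_mul _

/-- The constant `16 (1 + 2 / c₃)` is chosen so that the tail beats the entropy factor: one `N`
cancels `2 ^ N`, and `2 N / c₃ ≥ 2 d` cancels `2 ^ d` and leaves `exp (-d)`. -/
lemma two_pow_mul_exp_neg_le {d N : ℕ} {c₃ : ℝ} (hc₃ : 0 < c₃) (hN : c₃ * d ≤ N) :
    2 ^ (d + N) * Real.exp (-(16 * (1 + 2 / c₃) * N / 16)) ≤ Real.exp (-d) := by
  have h2 : (2 : ℝ) ≤ Real.exp 1 := by
    have := Real.add_one_le_exp (1 : ℝ)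
    linarith
  calc (2 : ℝ) ^ (d + N) * Real.exp (-(16 * (1 + 2 / c₃) * N / 16))
      ≤ Real.exp 1 ^ (d + N) * Real.exp (-(16 * (1 + 2 / c₃) * N / 16)) := by gcongr
    _ = Real.exp ((d + N) - (1 + 2 / c₃) * N) := by
        rw [← Real.exp_nat_mul, ← Real.exp_add]
        congr 1
        push_cast
        ring
    _ ≤ Real.exp (-d) := by
        refine Real.exp_le_exp.2 ?_
        have : (d : ℝ) ≤ N / c₃ := by
          rw [le_div_iff₀ hc₃]
          linarith
        have e : 2 / c₃ * N = 2 * (N / c₃) := by ring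
        linarith

end DecSSL

/-! ### Assembly of the theorem -/

theorem theorem1 (c₁ c₂ c₃ c₄ c₅ β : ℝ)
    (hc₁ : 0 < c₁) (hc₂ : 0 < c₂) (hc₃ : 0 < c₃) (hc₄ : 0 < c₄) (hc₅ : 0 < c₅)
    (hβ : β ∈ Set.Ioo (0 : ℝ) 1) :
    ∃ C : ℝ, 0 < C ∧ ∃ d₀ : ℕ, ∀ d : ℕ, d₀ ≤ d →
      ∀ (K : ℕ) (hKd : K ≤ d),
        -- `K = Θ(d^{1/20})`
        c₁ * (d : ℝ) ^ (1 / 20 : ℝ) ≤ (K : ℝ) → (K : ℝ) ≤ c₂ * (d : ℝ) ^ (1 / 20 : ℝ) →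
      ∀ m : ℕ, 2 * K ≤ m →
      ∀ n r : Fin K → ℕ,
        -- at least of order `d` points in each majority class
        (∀ k, c₃ * (d : ℝ) ≤ (n k : ℝ)) →
        -- `O(d^β)` points in each minority class, with `K d^β = O(d^{1/5})`
        (∀ k, (r k : ℝ) ≤ c₄ * (d : ℝ) ^ β) →
        (K : ℝ) * (d : ℝ) ^ β ≤ c₅ * (d : ℝ) ^ (1 / 5 : ℝ) →
        -- all local data sets have the same size
        (∀ k l, Fintype.card (DecSSL.SampleIdx n r k) = Fintype.card (DecSSL.SampleIdx n r l)) →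
      ∃ E : Set (∀ k : Fin K, DecSSL.SampleIdx n r k → EuclideanSpace ℝ (Fin d)),
        MeasurableSet E ∧
        1 - Real.exp (-(d : ℝ) ^ (1 / 10 : ℝ)) ≤ (DecSSL.dataLaw hKd n r).real E ∧
        ∀ x ∈ E,
          -- the local objectives
          (∀ k : Fin K,
            (∃ w : Matrix (Fin m) (Fin d) ℝ, IsMinOn (DecSSL.localLoss (x k)) Set.univ w) ∧
            ∀ w : Matrix (Fin m) (Fin d) ℝ, IsMinOn (DecSSL.localLoss (x k)) Set.univ w →
              ∀ i : Fin K, i ≠ k →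
                1 - C * (d : ℝ) ^ (-(4 / 5) : ℝ)
                    ≤ DecSSL.representability w (Fin.castLE hKd i) ∧
                  DecSSL.representability w (Fin.castLE hKd i) ≤ 1) ∧
          -- the global objective
          (∃ w : Matrix (Fin m) (Fin d) ℝ, IsMinOn (DecSSL.globalLoss x) Set.univ w) ∧
          ∀ w : Matrix (Fin m) (Fin d) ℝ, IsMinOn (DecSSL.globalLoss x) Set.univ w →
            ∀ i : Fin K,
              1 - C * (d : ℝ) ^ (-(4 / 5) : ℝ)
                  ≤ DecSSL.representability w (Fin.castLE hKd i) ∧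
                DecSSL.representability w (Fin.castLE hKd i) ≤ 1 := by
  have hgrow : ∀ᶠ d : ℕ in Filter.atTop, 2 / c₁ ≤ (d : ℝ) ^ (1 / 20 : ℝ) :=
    ((tendsto_rpow_atTop (by norm_num : (0 : ℝ) < 1 / 20)).comp
      tendsto_natCast_atTop_atTop).eventually_ge_atTop _
  obtain ⟨d₀, hd₀⟩ := Filter.eventually_atTop.1
    ((DecSSL.eventually_failure_bound_le hc₂ hc₃).and
      (hgrow.and (Filter.eventually_ge_atTop 1)))
  set b : ℝ := 16 * (1 + 2 / c₃) with hb
  -- Bounds `|D_k| / n_k`: the minority points number at most `K r_k ≤ c₄ c₅ d^{1/5} ≤ c₄ c₅ d ≤ (c₄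
  -- c₅ / c₃) n_k`.
  set c : ℝ := 2 + c₄ * c₅ / c₃ with hc
  have hbpos : 0 < b := by positivity
  have hcpos : 0 < c := by positivity
  refine ⟨64 * c * b, by positivity, d₀, ?_⟩
  intro d hd K hKd hK1 hK2 m hm n r hn hr hKβ hcards
  obtain ⟨hfail, hgrow, hd1⟩ := hd₀ d hd
  have hd1' : (1 : ℝ) ≤ d := by exact_mod_cast hd1
  have hK : 2 ≤ K := by
    have h1 : 2 ≤ c₁ * (d : ℝ) ^ (1 / 20 : ℝ) := by
      rw [div_le_iff₀ hc₁] at hgrow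
      linarith
    exact_mod_cast h1.trans hK1
  have hKm : K < m := by omega
  have hN : ∀ k, 0 < Fintype.card (DecSSL.SampleIdx n r k) := by
    intro k
    have h1 : (0 : ℝ) < n k := lt_of_lt_of_le (by positivity) (hn k)
    have h2 : 0 < n k := by exact_mod_cast h1
    exact h2.trans_le (DecSSL.le_card_sampleIdx n r k)
  have hcard : ∀ k, (Fintype.card (DecSSL.SampleIdx n r k) : ℝ) ≤ c * n k := by
    intro k
    have h1 : (Fintype.card (DecSSL.SampleIdx n r k) : ℝ) ≤ 2 * n k + K * r k := by
      exact_mod_cast DecSSL.card_sampleIdx_le n r k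
    have h2 : (K : ℝ) * r k ≤ c₄ * c₅ * d := by
      have h3 : (d : ℝ) ^ (1 / 5 : ℝ) ≤ d := by
        simpa using Real.rpow_le_rpow_of_exponent_le hd1' (by norm_num : (1 / 5 : ℝ) ≤ 1)
      calc (K : ℝ) * r k ≤ K * (c₄ * (d : ℝ) ^ β) := by
            have := hr k
            gcongr
        _ = c₄ * (K * (d : ℝ) ^ β) := by ring
        _ ≤ c₄ * (c₅ * (d : ℝ) ^ (1 / 5 : ℝ)) := by gcongr
        _ ≤ c₄ * (c₅ * d) := by gcongr
        _ = c₄ * c₅ * d := by ring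
    have h4 : c₄ * c₅ * d ≤ c₄ * c₅ / c₃ * n k := by
      calc c₄ * c₅ * d = c₄ * c₅ / c₃ * (c₃ * d) := by field_simp
        _ ≤ _ := by
          have := hn k
          gcongr
    rw [hc, add_mul]
    linarith
  -- From here on `μ` and `τ` denote the squares of the noise level and of the bit amplitude.
  set μ : ℝ := ((d : ℝ) ^ (-(1 / 5) : ℝ)) ^ 2 with hμ
  set τ : ℝ := ((d : ℝ) ^ (1 / 5 : ℝ)) ^ 2 with hτ
  have hμpos : 0 < μ := by positivity
  have hτpos : 0 < τ := by positivity
  -- The extra division of `κ` by `2` pays for the averaging in the global objective; the local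
  -- bounds are weakened to share the same constant.
  have hδ : (μ * b + μ * b) / (τ / (16 * c) / 2) =
      64 * c * b * (d : ℝ) ^ (-(4 / 5) : ℝ) := by
    have h1 : μ = (d : ℝ) ^ (-(4 / 5) : ℝ) * τ := by
      rw [hμ, hτ, ← Real.rpow_natCast, ← Real.rpow_natCast, ← Real.rpow_mul (by positivity),
        ← Real.rpow_mul (by positivity), ← Real.rpow_add (by positivity)]
      norm_num
    rw [h1]
    field_simp
    ring
  refine ⟨{x | ∀ k, DecSSL.IsWellSpread hKd n r k
    (b * Fintype.card (DecSSL.SampleIdx n r k)) (x k)}, ?_, ?_, ?_⟩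
  · simp only [Set.ofPred_forall]
    exact MeasurableSet.iInter fun k =>
      (DecSSL.isClosed_setOf_isWellSpread hKd n r k
        (b * Fintype.card (DecSSL.SampleIdx n r k))).measurableSet.preimage
        (measurable_pi_apply k)
  · refine le_trans (sub_le_sub_left (hfail K (by omega) hKd hK2) 1)
      (DecSSL.measureReal_dataLaw_forall_isWellSpread_ge hKd n r _ fun k => ?_)
    refine (DecSSL.measureReal_not_isWellSpread_le hKd n r k _).trans (add_le_add ?_ ?_)
    · refine DecSSL.two_pow_mul_exp_neg_le hc₃ ((hn k).trans ?_)
      exact_mod_cast DecSSL.le_card_sampleIdx n r k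
    · have := hn k
      gcongr
  · intro x hx
    have hglobal : (DecSSL.globalLoss x : Matrix (Fin m) (Fin d) ℝ → ℝ) =
        DecSSL.quarticLoss ((1 / (K : ℝ)) • ∑ k, DecSSL.secondMoment (x k)) :=
      DecSSL.globalLoss_eq_quarticLoss x (hN (⟨0, by omega⟩ : Fin K)) (by omega)
        fun k => hcards k _
    refine ⟨fun k => ?_, ?_, ?_⟩
    · rw [DecSSL.localLoss_eq_quarticLoss]
      refine ⟨DecSSL.exists_isMinOn_quarticLoss _, fun w hw i hi =>
        ⟨?_, DecSSL.representability_le_one w _⟩⟩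
      rw [← hδ]
      refine DecSSL.one_sub_le_representability_of_isMinOn hKd hKm _
        (DecSSL.isSymm_secondMoment (x k)) (by positivity) (by positivity) (by positivity)
        (fun v hv => (hx k).quadForm_le (hN k) v hv) i (fun v => ?_) w hw
      refine le_trans ?_ ((hx k).le_quadForm (hN k) hcpos (hcard k) v hi)
      exact mul_le_mul_of_nonneg_right (half_le_self (by positivity)) (sq_nonneg _)
    · rw [hglobal]
      exact DecSSL.exists_isMinOn_quarticLoss _
    · rw [hglobal]
      intro w hw i
      refine ⟨?_, DecSSL.representability_le_one w _⟩
      rw [← hδ]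
      refine DecSSL.one_sub_le_representability_of_isMinOn hKd hKm _
        (DecSSL.isSymm_average fun k => DecSSL.isSymm_secondMoment (x k)) (by positivity)
        (by positivity) (by positivity)
        (fun v hv => DecSSL.quadForm_average_le (by omega) fun k =>
          (hx k).quadForm_le (hN k) v hv) i (fun v => ?_) w hw
      rw [div_mul_eq_mul_div]
      have hvv : 0 ≤ dotProduct v v := by
        rw [DecSSL.dotProduct_self_eq_norm_sq]
        positivity
      exact DecSSL.half_mul_le_quadForm_average hK i (by positivity) (by positivity)
        (DecSSL.dotProduct_secondMoment_mulVec_nonneg (x i) v)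
        fun k hk => (hx k).le_quadForm (hN k) hcpos (hcard k) v hk
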